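/- For $\mu\in\mathbb{C}$ let $J^*_\mu(z)=\sum_{m\ge 0}\frac{(-1)^m (z/2)^{2m}}{m!\,\Gamma(\mu+m+1)}$, the entire function of $z$ which equals $J_\mu(z)(z/2)^{-\mu}$ for $z>0$. For $\nu\in\mathbb{C}$, $p\in\mathbb{Z}$ and $u\in\mathbb{C}\setminus\{0\}$ put $$\mathcal{J}_{\nu,p}(u)=|u/2|^{2\nu}\,(u/|u|)^{-2p}\,J^*_{\nu-p}(u)\,J^*_{\nu+p}(\bar u),\qquad \mathcal{K}_{\nu,p}(u)=\frac{\mathcal{J}_{-\nu,-p}(u)-\mathcal{J}_{\nu,p}(u)}{\sin \pi\nu},$$ where for $\nu\in\mathbb{Z}$ (a removable singularity) $\mathcal{K}_{\nu,p}(u)$ is the limit of this quotient. **Theorem 12.1.** Let $|\mathrm{Re}\,\nu|<\tfrac14$, $p\in\mathbb{Z}$, and let $u=|u|e^{i\vartheta}$ be a non-zero complex number, with $\vartheta\in\mathbb{R}$. Then $$\mathcal{K}_{\nu,p}(u)=(-1)^p\,\frac{2}{\pi}\int_0^\infty y^{2\nu-1}\left(\frac{x}{|x|}\right)^{2p}J_{2p}\big(|u||x|\big)\,dy,\qquad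 x=ye^{i\vartheta}+(ye^{i\vartheta})^{-1},$$ where $J_{2p}$ is the Bessel function of the first kind, and the integral converges absolutely. -/

import Mathlib

noncomputable section

namespace BesselKernel

open Filter Topology

/-- The entire function `J*_μ(z)`, equal to `J_μ(z) (z/2)^(-μ)` for `z > 0`, given by its power
series `∑ (-1)^m (z/2)^(2m) / (m! Γ(μ+m+1))`. The reciprocal `1/Γ` is entire and vanishes at the
poles of `Γ`, in agreement with the convention `Complex.Gamma (-n) = 0`, `0⁻¹ = 0`. -/
def besselJStar (μ z : ℂ) : ℂ :=
  ∑' m : ℕ, (-1 : ℂ) ^ m / (m.factorial : ℂ) * (Complex.Gamma (μ + m + 1))⁻¹ * (z / 2) ^ (2 * m)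

/-- The Bessel function of the first kind `J_n(z) = (z/2)^n J*_n(z)` of integral order. -/
def besselJ (n : ℤ) (z : ℂ) : ℂ :=
  (z / 2) ^ n * besselJStar n z

/-- The function `𝒥_{ν,p}(u) = |u/2|^(2ν) (u/|u|)^(-2p) J*_{ν-p}(u) J*_{ν+p}(ū)`, for `u ≠ 0`. -/
def scrJ (ν : ℂ) (p : ℤ) (u : ℂ) : ℂ :=
  ((‖u / 2‖ : ℝ) : ℂ) ^ (2 * ν) * (u / (‖u‖ : ℂ)) ^ (-2 * p) *
    besselJStar (ν - p) u * besselJStar (ν + p) (starRingEnd ℂ u)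

/-- The quotient `(𝒥_{-ν,-p}(u) - 𝒥_{ν,p}(u)) / sin πν`. -/
def kernelQuotient (ν : ℂ) (p : ℤ) (u : ℂ) : ℂ :=
  (scrJ (-ν) (-p) u - scrJ ν p u) / Complex.sin (Real.pi * ν)

/-- The Bessel kernel `𝒦_{ν,p}(u) = (𝒥_{-ν,-p}(u) - 𝒥_{ν,p}(u)) / sin πν`. At the zeros of
`sin πν`, which are removable singularities, it is the limit of the quotient. -/
def scrK (ν : ℂ) (p : ℤ) (u : ℂ) : ℂ :=
  if Complex.sin (Real.pi * ν) = 0 then limUnder (𝓝[≠] ν) (fun s => kernelQuotient s p u)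
  else kernelQuotient ν p u

/-- The complex number `y e^{iϑ} + (y e^{iϑ})⁻¹`. -/
def joukowski (ϑ y : ℝ) : ℂ :=
  (y : ℂ) * Complex.exp (Complex.I * ϑ) + ((y : ℂ) * Complex.exp (Complex.I * ϑ))⁻¹

/-- The integrand `y^(2ν-1) (x/|x|)^(2p) J_{2p}(r|x|)`, where `x = y e^{iϑ} + (y e^{iϑ})⁻¹`. -/
def integrand (ν : ℂ) (p : ℤ) (r ϑ y : ℝ) : ℂ :=
  (y : ℂ) ^ (2 * ν - 1) *
    (joukowski ϑ y / (‖joukowski ϑ y‖ : ℂ)) ^ (2 * p) *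
    besselJ (2 * p) ((r * ‖joukowski ϑ y‖ : ℝ) : ℂ)

end BesselKernel

end

noncomputable section

namespace BesselKernel

open Filter Topology Set MeasureTheory

/-! Dilate `u` to `√τ u`, multiply by `τ ^ p`, and compare Laplace transforms in `τ`, for `p ≥ 0`
and `ν` not an integer.

On the integral side, `z = |u| x` equals `y u + ū / y`, and the transform of `τ^p (z/|z|)^(2p)
J_{2p}(√τ |z|)` is `s^(-2p-1) (z/2)^(2p) exp(-|z|²/4s)` (`laplace_pow_mul_clifford`). Since `|z|² =
u² + ū² + |u|² (y² + y⁻²)`, the binomial expansion of `z^(2p)` turns the `y`-integral into a finite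
sum of Macdonald functions `K_{ν+j-p}(2X)` with `X = |u|²/4s` (`integral_ellipse_pow_mul_exp`).

On the kernel side, `𝒥_{ν,p}` is a product of two Bessel functions whose orders differ by `2p`. An
extension of Weber's second exponential integral (`laplace_clifford_mul_clifford`) gives the same
exponential factors times a sum of `(-1)^j I_{ν+j-p}(2X)` with the same binomial weights
(`laplace_scaledScrJ`). The two sides agree term by term through `K_w = (π/2) (I_{-w} - I_w) / sin
πw` (`macdonald_eq`). Uniqueness of the Laplace transform (`eq_zero_of_laplace_eq_zero`) then allows
`τ = 1`.

The analytic input is the uniform bound `J_{2p}(x) = O((1 + x²)^(-1/4))`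
(`exists_pow_four_besselJ_le`): it gives absolute convergence for `|Re ν| < 1/4` and justifies
Fubini. The value `ν = 0` follows by continuity, and negative `p` by complex conjugation. -/

/-! ### Growth of `1/Γ` and the Bessel–Clifford function -/

theorem exists_le_const_mul_two_pow (a : ℕ → ℝ) (h : ∀ᶠ k in atTop, a (k + 1) ≤ 2 * a k) :
    ∃ C : ℝ, 0 ≤ C ∧ ∀ k, a k ≤ C * 2 ^ k := by
  obtain ⟨N, hN⟩ := eventually_atTop.1 h
  have h0 : ∀ k ∈ Finset.range (N + 1), 0 ≤ |a k| := fun k _ => abs_nonneg _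
  refine ⟨∑ k ∈ Finset.range (N + 1), |a k|, Finset.sum_nonneg h0, ?_⟩
  have small : ∀ k ≤ N, a k ≤ ∑ k ∈ Finset.range (N + 1), |a k| := fun k hk =>
    (le_abs_self _).trans
      (Finset.single_le_sum h0 (Finset.mem_range.2 (Nat.lt_succ_of_le hk)))
  intro k
  rcases le_total k N with hk | hk
  · exact (small k hk).trans
      (le_mul_of_one_le_right (Finset.sum_nonneg h0) (one_le_pow₀ one_le_two))
  · induction k, hk using Nat.le_induction with
    | base =>
      exact (small N le_rfl).trans
        (le_mul_of_one_le_right (Finset.sum_nonneg h0) (one_le_pow₀ one_le_two))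
    | succ k hk ih =>
      have := hN k hk
      rw [pow_succ]
      linarith

/-- Passing from `k` to `k + 1` multiplies `k! / |Γ(α+k+1)|` by `(k+1) / |α+k+1|`, which is at most
2 once `k ≥ 2‖α‖`. -/
theorem norm_inv_Gamma_le (α : ℂ) :
    ∃ C : ℝ, 0 ≤ C ∧ ∀ k : ℕ, ‖(Complex.Gamma (α + k + 1))⁻¹‖ ≤ C * 2 ^ k / k.factorial := by
  obtain ⟨C, hC, h⟩ := exists_le_const_mul_two_pow
    (fun k : ℕ => k.factorial * ‖(Complex.Gamma (α + k + 1))⁻¹‖) (by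
      filter_upwards [eventually_ge_atTop ⌈2 * ‖α‖⌉₊] with k hk
      have hk' : 2 * ‖α‖ ≤ k := Nat.ceil_le.1 hk
      have h1 : ((k : ℝ) + 1) / 2 ≤ ‖α + k + 1‖ := by
        have h2 : ‖((k + 1 : ℕ) : ℂ)‖ ≤ ‖α + k + 1‖ + ‖α‖ := by
          have := norm_sub_le (α + k + 1) α
          rwa [show α + k + 1 - α = ((k + 1 : ℕ) : ℂ) by push_cast; ring] at this
        rw [Complex.norm_natCast] at h2
        push_cast at h2
        linarith
      have h3 : ‖(Complex.Gamma (α + k + 1))⁻¹‖ =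
          ‖α + k + 1‖ * ‖(Complex.Gamma (α + (k + 1 : ℕ) + 1))⁻¹‖ := by
        rw [Complex.one_div_Gamma_eq_self_mul_one_div_Gamma_add_one, norm_mul]
        push_cast
        rw [← add_assoc α]
      rw [h3, Nat.factorial_succ]
      push_cast
      have h4 : 0 ≤ ‖(Complex.Gamma (α + (k + 1) + 1))⁻¹‖ := norm_nonneg _
      have h5 : (0 : ℝ) ≤ k.factorial := by positivity
      nlinarith [mul_le_mul_of_nonneg_right h1 (mul_nonneg h5 h4)])
  refine ⟨C, hC, fun k => ?_⟩
  rw [le_div_iff₀ (by positivity), mul_comm]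
  exact h k

/-- The Bessel–Clifford function, an entire function of both variables. -/
def clifford (μ Z : ℂ) : ℂ :=
  ∑' k : ℕ, (k.factorial : ℂ)⁻¹ * (Complex.Gamma (μ + k + 1))⁻¹ * Z ^ k

theorem norm_clifford_term_le (μ : ℂ) : ∃ C : ℝ, 0 ≤ C ∧ ∀ (Z : ℂ) (k : ℕ),
    ‖(k.factorial : ℂ)⁻¹ * (Complex.Gamma (μ + k + 1))⁻¹ * Z ^ k‖ ≤
      C * ((2 * ‖Z‖) ^ k / k.factorial) := by
  obtain ⟨C, hC, h⟩ := norm_inv_Gamma_le μ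
  refine ⟨C, hC, fun Z k => ?_⟩
  have hf : (1 : ℝ) ≤ k.factorial := by exact_mod_cast k.factorial_pos
  have h1 : ‖(Complex.Gamma (μ + k + 1))⁻¹‖ ≤ C * 2 ^ k := (h k).trans
    (div_le_self (by positivity) hf)
  rw [norm_mul, norm_mul, norm_pow, norm_inv, Complex.norm_natCast, mul_pow]
  calc (k.factorial : ℝ)⁻¹ * ‖(Complex.Gamma (μ + k + 1))⁻¹‖ * ‖Z‖ ^ k
      ≤ (k.factorial : ℝ)⁻¹ * (C * 2 ^ k) * ‖Z‖ ^ k := by gcongr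
    _ = _ := by ring

theorem summable_norm_clifford (μ Z : ℂ) :
    Summable fun k : ℕ => ‖(k.factorial : ℂ)⁻¹ * (Complex.Gamma (μ + k + 1))⁻¹ * Z ^ k‖ := by
  obtain ⟨C, hC, h⟩ := norm_clifford_term_le μ
  exact Summable.of_nonneg_of_le (fun _ => norm_nonneg _) (h Z)
    ((Real.summable_pow_div_factorial _).mul_left C)

theorem hasSum_clifford (μ Z : ℂ) :
    HasSum (fun k : ℕ => (k.factorial : ℂ)⁻¹ * (Complex.Gamma (μ + k + 1))⁻¹ * Z ^ k)
      (clifford μ Z) :=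
  (summable_norm_clifford μ Z).of_norm.hasSum

theorem hasSum_clifford_deriv (μ Z : ℂ) :
    HasSum (fun k : ℕ => (k.factorial : ℂ)⁻¹ * (Complex.Gamma (μ + k + 1))⁻¹ *
      (k * Z ^ (k - 1))) (clifford (μ + 1) Z) := by
  refine (hasSum_nat_add_iff' 1).1 ?_
  simp only [Finset.range_one, Finset.sum_singleton, Nat.cast_zero, zero_mul, mul_zero, sub_zero]
  convert! hasSum_clifford (μ + 1) Z using 2 with k
  have h1 : ((k : ℂ) + 1) ≠ 0 := by exact_mod_cast k.succ_ne_zero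
  have h2 : (k.factorial : ℂ) ≠ 0 := by exact_mod_cast k.factorial_ne_zero
  rw [Nat.factorial_succ, show μ + ((k + 1 : ℕ) : ℂ) + 1 = μ + 1 + k + 1 by push_cast; ring,
    Nat.add_sub_cancel]
  push_cast
  field_simp

/-- In this normalisation of the Bessel functions, differentiation only raises the order by one. -/
theorem hasDerivAt_clifford (μ Z : ℂ) :
    HasDerivAt (clifford μ) (clifford (μ + 1) Z) Z := by
  -- On the ball of radius `R` the differentiated terms are dominated by their values at `R`, which
  -- are summable.
  set R : ℝ := ‖Z‖ + 1
  have key := hasDerivAt_tsum_of_isPreconnected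
    (u := fun k : ℕ => ‖(k.factorial : ℂ)⁻¹ * (Complex.Gamma (μ + k + 1))⁻¹ *
      (k * (R : ℂ) ^ (k - 1))‖)
    (g := fun (k : ℕ) Z => (k.factorial : ℂ)⁻¹ * (Complex.Gamma (μ + k + 1))⁻¹ * Z ^ k)
    (g' := fun (k : ℕ) Z => (k.factorial : ℂ)⁻¹ * (Complex.Gamma (μ + k + 1))⁻¹ *
      (k * Z ^ (k - 1))) (t := Metric.ball 0 R) (y₀ := 0) (y := Z)
    (summable_norm_iff.2 (hasSum_clifford_deriv μ R).summable) Metric.isOpen_ball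
    (convex_ball 0 R).isPreconnected (fun k y _ => (hasDerivAt_pow k y).const_mul _)
    (fun k y hy => by
      have hy' : ‖y‖ ≤ ‖(R : ℂ)‖ := by
        rw [Complex.norm_real]
        exact (mem_ball_zero_iff.1 hy).le.trans (le_abs_self R)
      simp only [norm_mul, norm_pow]
      gcongr)
    (Metric.mem_ball_self (by positivity)) (hasSum_clifford μ 0).summable
    (by simp [R])
  rwa [(hasSum_clifford_deriv μ Z).tsum_eq] at key

theorem continuous_clifford (μ : ℂ) : Continuous (clifford μ) :=
  continuous_iff_continuousAt.2 fun Z => (hasDerivAt_clifford μ Z).continuousAt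

/-- The three-term recurrence. It comes from `1/Γ(μ+k+1) = (μ+1+k)/Γ(μ+k+2)`: the part `μ + 1` gives
the first series, the part `k` gives `Z` times a derivative. -/
theorem clifford_eq (μ Z : ℂ) :
    clifford μ Z = (μ + 1) * clifford (μ + 1) Z + Z * clifford (μ + 2) Z := by
  have h1 := ((hasSum_clifford (μ + 1) Z).mul_left (μ + 1)).add
    ((hasSum_clifford_deriv (μ + 1) Z).mul_left Z)
  rw [show μ + 1 + 1 = μ + 2 by ring] at h1
  refine (hasSum_clifford μ Z).unique ?_
  convert! h1 using 2 with k
  rw [Complex.one_div_Gamma_eq_self_mul_one_div_Gamma_add_one (μ + k + 1),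
    show μ + 1 + k + 1 = μ + k + 1 + 1 by ring]
  rcases k with _ | k
  · simp
  · simp only [Nat.add_sub_cancel, pow_succ]
    ring

/-- The first `n` coefficients are reciprocals of `Γ` at its poles, where `Complex.Gamma` takes the
value 0, so they vanish and the series starts at `Z ^ n`. -/
theorem clifford_neg_nat (n : ℕ) (Z : ℂ) : clifford (-n) Z = Z ^ n * clifford n Z := by
  refine (hasSum_clifford (-n) Z).unique ((hasSum_nat_add_iff' n).1 ?_)
  rw [Finset.sum_eq_zero, sub_zero]
  · convert! (hasSum_clifford n Z).mul_left (Z ^ n) using 2 with k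
    have h1 : (-n : ℂ) + (k + n : ℕ) + 1 = k + 1 := by push_cast; ring
    have h2 : (n : ℂ) + k + 1 = (k + n : ℕ) + 1 := by push_cast; ring
    rw [h1, h2, Complex.Gamma_nat_eq_factorial, Complex.Gamma_nat_eq_factorial, pow_add]
    ring
  · intro k hk
    have hk' := Finset.mem_range.1 hk
    have : (-n : ℂ) + k + 1 = -((n - k - 1 : ℕ) : ℂ) := by
      rw [Nat.sub_sub, Nat.cast_sub (by omega)]
      push_cast; ring
    rw [this, Complex.Gamma_neg_nat_eq_zero]
    simp

theorem besselJStar_eq (μ z : ℂ) : besselJStar μ z = clifford μ (-(z / 2) ^ 2) := by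
  unfold besselJStar clifford
  congr 1; ext m
  rw [neg_pow ((z / 2) ^ 2), ← pow_mul]
  ring

theorem clifford_nat_ofReal_im (n : ℕ) (x : ℝ) : (clifford n x).im = 0 := by
  have h := (hasSum_clifford n x)
  have h2 := Complex.hasSum_im h
  refine h2.unique ?_
  convert! hasSum_zero with k
  have : (n : ℂ) + k + 1 = ((n + k : ℕ) : ℂ) + 1 := by push_cast; ring
  rw [this, Complex.Gamma_nat_eq_factorial]
  have : ((k.factorial : ℂ)⁻¹ * ((n + k).factorial : ℂ)⁻¹ * (x : ℂ) ^ k) =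
    (((k.factorial : ℝ)⁻¹ * ((n + k).factorial : ℝ)⁻¹ * x ^ k : ℝ) : ℂ) := by push_cast; rfl
  rw [this, Complex.ofReal_im]

/-! ### Uniqueness for the differential system of the Macdonald functions -/

/-- The mean value inequality on `[ε, Z]` with `ε → 0`; the derivatives may be singular at 0. -/
theorem norm_le_of_norm_deriv_le_of_tendsto_zero {F F' : ℝ → ℂ} {B B' : ℝ → ℝ} {R : ℝ}
    (hF : ∀ t ∈ Ioc 0 R, HasDerivAt F (F' t) t) (hB : ∀ t ∈ Ioc 0 R, HasDerivAt B (B' t) t)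
    (hle : ∀ t ∈ Ioc 0 R, ‖F' t‖ ≤ B' t) (hF0 : Tendsto F (𝓝[>] 0) (𝓝 0))
    (hB0 : Tendsto B (𝓝[>] 0) (𝓝 0)) {Z : ℝ} (hZ : Z ∈ Ioc 0 R) : ‖F Z‖ ≤ B Z := by
  have h1 : ∀ᶠ ε in 𝓝[>] (0 : ℝ), ‖F Z - F ε‖ ≤ B Z - B ε := by
    filter_upwards [Ioo_mem_nhdsGT hZ.1] with ε hε
    have sub : ∀ t ∈ Icc ε Z, t ∈ Ioc 0 R := fun t ht =>
      ⟨hε.1.trans_le ht.1, ht.2.trans hZ.2⟩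
    refine image_norm_le_of_norm_deriv_right_le_deriv_boundary' (a := ε) (b := Z)
      (f := fun t => F t - F ε) (f' := F') (B := fun t => B t - B ε) (B' := B')
      (fun t ht => ((hF t (sub t ht)).sub_const _).continuousAt.continuousWithinAt)
      (fun t ht => ((hF t (sub t (Ico_subset_Icc_self ht))).sub_const _).hasDerivWithinAt)
      (by simp)
      (fun t ht => ((hB t (sub t ht)).sub_const _).continuousAt.continuousWithinAt)
      (fun t ht => ((hB t (sub t (Ico_subset_Icc_self ht))).sub_const _).hasDerivWithinAt)
      (fun t ht => hle t (sub t (Ico_subset_Icc_self ht))) ⟨hε.2.le, le_rfl⟩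
  have h2 := le_of_tendsto_of_tendsto ((tendsto_const_nhds.sub hF0).norm)
    (tendsto_const_nhds.sub hB0) h1
  simpa using h2

/-- Picard iteration with singular coefficients. If `Q = O(Z^n)`, integrating `Z^(σ-1+n)` gives `P =
O(Z^(n+σ))`; the factor `Z^(-σ)` cancels the gain `Z^σ`, and a second integration gives `Q =
O(Z^(n+1))`. Replacing the denominator `n + σ` by `σ` leaves the bound `C (Z/σ)^n / n!`, which tends
to 0. -/
theorem eq_zero_of_hasDerivAt_rpow_system {P Q P' Q' : ℝ → ℂ} {σ : ℝ} (hσ : 0 < σ)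
    (hP : ∀ Z > 0, HasDerivAt P (P' Z) Z) (hQ : ∀ Z > 0, HasDerivAt Q (Q' Z) Z)
    (hP' : ∀ Z > 0, ‖P' Z‖ ≤ Z ^ (σ - 1) * ‖Q Z‖) (hQ' : ∀ Z > 0, ‖Q' Z‖ ≤ Z ^ (-σ) * ‖P Z‖)
    (hP0 : Tendsto P (𝓝[>] 0) (𝓝 0)) (hQ0 : Tendsto Q (𝓝[>] 0) (𝓝 0)) {R : ℝ} (hR : 0 < R) :
    P R = 0 ∧ Q R = 0 := by
  have bdd : ∀ R > 0, ∃ C : ℝ, ∀ Z ∈ Ioc 0 R, ‖Q Z‖ ≤ C := by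
    intro R hR
    have h1 : ∀ᶠ Z in 𝓝[>] (0 : ℝ), ‖Q Z‖ < 1 := by
      have := hQ0.norm
      rw [norm_zero] at this
      exact this.eventually_lt_const one_pos
    obtain ⟨ε, hε, h2⟩ := mem_nhdsGT_iff_exists_Ioc_subset.1 h1
    obtain ⟨C, hC⟩ := (isCompact_Icc (a := ε) (b := R)).exists_bound_of_continuousOn (f := Q)
      (fun t ht => (hQ t (lt_of_lt_of_le hε ht.1)).continuousAt.continuousWithinAt)
    refine ⟨max 1 C, fun Z hZ => ?_⟩
    rcases le_total Z ε with h | h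
    · exact (h2 ⟨hZ.1, h⟩).le.trans (le_max_left _ _)
    · exact (hC Z ⟨h, hZ.2⟩).trans (le_max_right _ _)
  have hQz : ∀ R > 0, Q R = 0 := by
    intro R hR
    obtain ⟨C, hC⟩ := bdd R hR
    have hC0 : 0 ≤ C := (norm_nonneg _).trans (hC R ⟨hR, le_rfl⟩)
    have key : ∀ n : ℕ, ∀ Z ∈ Ioc 0 R, ‖Q Z‖ ≤ C * ((Z / σ) ^ n / n.factorial) := by
      intro n
      induction n with
      | zero => simpa using hC
      | succ n ih =>
        have hn : 0 < (n : ℝ) + σ := by positivity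
        have bP : ∀ Z ∈ Ioc 0 R,
            ‖P Z‖ ≤ C / (σ ^ n * n.factorial) * (Z ^ (n + σ) / (n + σ)) := by
          intro Z hZ
          refine norm_le_of_norm_deriv_le_of_tendsto_zero
            (B := fun Z => C / (σ ^ n * n.factorial) * (Z ^ (n + σ) / (n + σ)))
            (B' := fun Z => C / (σ ^ n * n.factorial) * Z ^ (n + σ - 1))
            (fun t ht => hP t ht.1) ?_ ?_ hP0 ?_ hZ
          · intro t ht
            convert! ((Real.hasDerivAt_rpow_const (x := t) (p := n + σ)
              (Or.inl ht.1.ne')).div_const (n + σ)).const_mul (C / (σ ^ n * n.factorial)) using 1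
            field_simp
          · intro t ht
            refine (hP' t ht.1).trans ((mul_le_mul_of_nonneg_left (ih t ht)
              (Real.rpow_nonneg ht.1.le _)).trans (le_of_eq ?_))
            rw [show (n : ℝ) + σ - 1 = (σ - 1) + n by ring, Real.rpow_add ht.1, Real.rpow_natCast,
              div_pow]
            field_simp
          · have : Tendsto (fun Z : ℝ => C / (σ ^ n * n.factorial) * (Z ^ (n + σ) / (n + σ)))
                (𝓝 0) (𝓝 (C / (σ ^ n * n.factorial) * ((0 : ℝ) ^ (n + σ) / (n + σ)))) :=
              ((Real.continuousAt_rpow_const _ _ (Or.inr hn.le)).tendsto.div_const _).const_mul _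
            rw [Real.zero_rpow hn.ne'] at this
            simpa using this.mono_left nhdsWithin_le_nhds
        intro Z hZ
        refine norm_le_of_norm_deriv_le_of_tendsto_zero
          (B := fun Z => C * ((Z / σ) ^ (n + 1) / (n + 1).factorial))
          (B' := fun Z => C / (σ ^ (n + 1) * n.factorial) * Z ^ n)
          (fun t ht => hQ t ht.1) ?_ ?_ hQ0 ?_ hZ
        · intro t ht
          convert! ((((hasDerivAt_id t).div_const σ).pow (n + 1)).div_const
            ((n + 1).factorial : ℝ)).const_mul C using 1
          rw [Nat.factorial_succ]
          push_cast
          have : (0 : ℝ) < n.factorial := by positivity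
          simp only [id, div_pow, pow_succ]
          field_simp
        · intro t ht
          refine (hQ' t ht.1).trans ((mul_le_mul_of_nonneg_left (bP t ht)
            (Real.rpow_nonneg ht.1.le _)).trans ?_)
          rw [Real.rpow_add ht.1, Real.rpow_neg ht.1.le, Real.rpow_natCast]
          have h1 : 0 < t ^ σ := Real.rpow_pos_of_pos ht.1 σ
          have h2 : (0 : ℝ) < n.factorial := by positivity
          have h3 : (t ^ σ)⁻¹ * (C / (σ ^ n * n.factorial) * (t ^ n * t ^ σ / (n + σ))) =
              C / (σ ^ n * n.factorial) * t ^ n / (n + σ) := by field_simp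
          have h4 : C / (σ ^ (n + 1) * n.factorial) * t ^ n =
              C / (σ ^ n * n.factorial) * t ^ n / σ := by
            rw [pow_succ]; field_simp
          rw [h3, h4]
          have := ht.1
          gcongr
          linarith [(Nat.cast_nonneg n : (0 : ℝ) ≤ n)]
        · have : Tendsto (fun Z : ℝ => C * ((Z / σ) ^ (n + 1) / (n + 1).factorial)) (𝓝 0)
              (𝓝 (C * ((0 / σ) ^ (n + 1) / (n + 1).factorial))) :=
            Continuous.tendsto (by fun_prop) 0
          simpa using this.mono_left nhdsWithin_le_nhds
    have h5 : Tendsto (fun n : ℕ => C * ((R / σ) ^ n / n.factorial)) atTop (𝓝 0) := by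
      simpa using (FloorSemiring.tendsto_pow_div_factorial_atTop (R / σ)).const_mul C
    exact norm_le_zero_iff.1 (ge_of_tendsto' h5 fun n => key n R ⟨hR, le_rfl⟩)
  refine ⟨norm_le_zero_iff.1 ?_, hQz R hR⟩
  refine norm_le_of_norm_deriv_le_of_tendsto_zero (B := fun _ => 0) (B' := fun _ => 0)
    (fun t (ht : t ∈ Ioc 0 R) => hP t ht.1) (fun t _ => hasDerivAt_const t 0) (fun t ht => ?_)
    hP0 tendsto_const_nhds ⟨hR, le_rfl⟩
  simpa [hQz t ht.1] using hP' t ht.1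

/-- A family with the derivation law and the symmetry of the Macdonald functions vanishes if its
members of positive order tend to zero at the origin. -/
theorem macdonald_family_eq_zero {D : ℂ → ℝ → ℂ}
    (hD : ∀ w : ℂ, (∀ n : ℤ, w ≠ n) → ∀ Z > 0, HasDerivAt (D w) (-D (w - 1) Z) Z)
    (hs : ∀ w : ℂ, (∀ n : ℤ, w ≠ n) → ∀ Z > 0, D (-w) Z = (Z : ℂ) ^ (-w) * D w Z)
    (hl : ∀ w : ℂ, (∀ n : ℤ, w ≠ n) → 0 < w.re → Tendsto (D w) (𝓝[>] 0) (𝓝 0))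
    {w : ℂ} (hw : ∀ n : ℤ, w ≠ n) {Z : ℝ} (hZ : 0 < Z) : D w Z = 0 := by
  have hneg : ∀ {w : ℂ}, (∀ n : ℤ, w ≠ n) → ∀ n : ℤ, -w ≠ n := fun {w} h n hn =>
    h (-n) (by push_cast; rw [← hn, neg_neg])
  have hadd : ∀ {w : ℂ} (m : ℤ), (∀ n : ℤ, w ≠ n) → ∀ n : ℤ, w + m ≠ n := fun {w} m h n hn =>
    h (n - m) (by push_cast; rw [← hn]; ring)
  have hsub : ∀ {w : ℂ}, (∀ n : ℤ, w ≠ n) → ∀ n : ℤ, 1 - w ≠ n := fun {w} h n => by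
    have := hadd 1 (hneg h) n
    rwa [Int.cast_one, neg_add_eq_sub] at this
  have hs' : ∀ w : ℂ, (∀ n : ℤ, w ≠ n) → ∀ Z > 0, D (w - 1) Z = (Z : ℂ) ^ (w - 1) * D (1 - w) Z := by
    intro w hw Z hZ
    have := hs (1 - w) (hsub hw) Z hZ
    rwa [neg_sub] at this
  -- On the line `Re v = 0` no limit is assumed. Differentiating the symmetry relation gives `v D_v
  -- = D_{v+1} - Z^v D_{1-v}`, where both orders on the right have real part 1 and `|Z^v| = 1`.
  have hl0 : ∀ v : ℂ, (∀ n : ℤ, v ≠ n) → v.re = 0 → Tendsto (D v) (𝓝[>] 0) (𝓝 0) := by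
    intro v hv hv0
    have hvne : v ≠ 0 := by simpa using hv 0
    have recur : ∀ Z > 0, D v Z = v⁻¹ * (D (v + 1) Z - (Z : ℂ) ^ v * D (1 - v) Z) := by
      intro Z hZ
      have hZ' : (Z : ℂ) ≠ 0 := by exact_mod_cast hZ.ne'
      have d1 := hD (-v) (hneg hv) Z hZ
      have d2 : HasDerivAt (fun Z : ℝ => (Z : ℂ) ^ (-v) * D v Z)
          (-v * (Z : ℂ) ^ (-v - 1) * D v Z + (Z : ℂ) ^ (-v) * -D (v - 1) Z) Z := by
        have h3 : HasDerivAt (fun Z : ℝ => (Z : ℂ) ^ (-v)) (-v * (Z : ℂ) ^ (-v - 1)) Z := by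
          have := ((hasDerivAt_id (Z : ℂ)).cpow_const (c := -v)
            (Or.inl (by simpa using hZ))).comp_ofReal
          simpa using this
        exact h3.mul (hD v hv Z hZ)
      have e1 := d1.unique (d2.congr_of_eventuallyEq
        ((eventually_gt_nhds hZ).mono fun t ht => hs v hv t ht))
      have h4 := hs (v + 1) (by simpa using hadd 1 hv) Z hZ
      rw [hs' v hv Z hZ, show -v - 1 = -(v + 1) by ring, h4] at e1
      have h5 : (Z : ℂ) ^ (-v) * (Z : ℂ) ^ (v - 1) = (Z : ℂ) ^ (-(v + 1)) * (Z : ℂ) ^ v := by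
        rw [← Complex.cpow_add _ _ hZ', ← Complex.cpow_add _ _ hZ']
        ring_nf
      have h6 : (Z : ℂ) ^ (-(v + 1)) ≠ 0 := by simp [Complex.cpow_eq_zero_iff, hZ']
      rw [eq_inv_mul_iff_mul_eq₀ hvne]
      apply mul_left_cancel₀ h6
      linear_combination e1 - D (1 - v) Z * h5
    have t1 : Tendsto (fun Z : ℝ => (Z : ℂ) ^ v * D (1 - v) Z) (𝓝[>] 0) (𝓝 0) := by
      have h1 := hl (1 - v) (hsub hv) (by simp [hv0])
      refine squeeze_zero_norm' ?_ (by simpa using h1.norm)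
      filter_upwards [self_mem_nhdsWithin] with Z hZ
      rw [norm_mul, Complex.norm_cpow_eq_rpow_re_of_pos hZ, hv0]
      simp
    have t2 := (hl (v + 1) (by simpa using hadd 1 hv) (by simp [hv0])).sub t1
    have t3 := t2.const_mul v⁻¹
    rw [sub_zero, mul_zero] at t3
    exact t3.congr' (eventually_mem_nhdsWithin.mono fun Z hZ => (recur Z hZ).symm)
  -- By the symmetry, `D_w` and `D_{1-w}` form a closed first-order system. When `Re w = 1` the
  -- partner has order of real part 0, whence `hl0`.
  have base : ∀ w : ℂ, (∀ n : ℤ, w ≠ n) → 0 < w.re → w.re ≤ 1 → ∀ Z > 0, D w Z = 0 := by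
    intro w hw h0 h1 Z hZ
    refine (eq_zero_of_hasDerivAt_rpow_system (P := D w) (Q := D (1 - w)) h0 (hD w hw)
      (hD (1 - w) (hsub hw)) ?_ ?_ (hl w hw h0) ?_ hZ).1
    · intro Z hZ
      rw [norm_neg, hs' w hw Z hZ, norm_mul, Complex.norm_cpow_eq_rpow_re_of_pos hZ]
      simp
    · intro Z hZ
      rw [norm_neg, show 1 - w - 1 = -w by ring, hs w hw Z hZ, norm_mul,
        Complex.norm_cpow_eq_rpow_re_of_pos hZ]
      simp
    · rcases h1.lt_or_eq with h | h
      · exact hl _ (hsub hw) (by simpa using h)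
      · exact hl0 _ (hsub hw) (by simp [h])
  -- The derivative of a function that vanishes identically is zero, and it is minus the member of
  -- the next lower order.
  have down : ∀ n : ℕ, ∀ w : ℂ, (∀ n : ℤ, w ≠ n) → 0 < w.re → w.re ≤ 1 → ∀ Z > 0,
      D (w - n) Z = 0 := by
    intro n
    induction n with
    | zero => simpa using base
    | succ n ih =>
      intro w hw h0 h1 Z hZ
      have hwn : ∀ m : ℤ, w - n ≠ m := by
        have := hadd (-n) hw
        simpa [sub_eq_add_neg] using this
      have e := (hD (w - n) hwn Z hZ).unique ((hasDerivAt_const Z (0 : ℂ)).congr_of_eventuallyEq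
        ((eventually_gt_nhds hZ).mono fun t ht => ih w hw h0 h1 t ht))
      rw [show w - ((n + 1 : ℕ) : ℂ) = w - n - 1 by push_cast; ring]
      exact neg_eq_zero.1 e
  have low : ∀ w : ℂ, (∀ n : ℤ, w ≠ n) → w.re ≤ 1 → ∀ Z > 0, D w Z = 0 := by
    intro w hw h1 Z hZ
    have hc : (⌈w.re⌉ : ℤ) ≤ 1 := Int.ceil_le.2 (by simpa using h1)
    -- The shift `n = 1 - ⌈Re w⌉` brings `w + n` into the strip `0 < Re ≤ 1`.
    obtain ⟨n, hn⟩ := Int.eq_ofNat_of_zero_le (sub_nonneg.2 hc)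
    have hn' : ((n : ℤ) : ℝ) = 1 - (⌈w.re⌉ : ℝ) := by rw [← hn]; push_cast; ring
    rw [Int.cast_natCast] at hn'
    have := down n (w + n) (by simpa using hadd n hw)
      (by simp only [Complex.add_re, Complex.natCast_re]; linarith [Int.ceil_lt_add_one w.re])
      (by simp only [Complex.add_re, Complex.natCast_re]; linarith [Int.le_ceil w.re]) Z hZ
    simpa using this
  rcases le_total w.re 1 with h | h
  · exact low w hw h Z hZ
  · have h1 := hs (-w) (hneg hw) Z hZ
    rw [neg_neg, low (-w) (hneg hw) (by simp only [Complex.neg_re]; linarith) Z hZ, mul_zero] at h1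
    exact h1

/-! ### The Macdonald function as a Mellin transform -/

/-- The bound `exp(-Z/t) ≤ n! (t/Z)^n` with `n > -σ` absorbs the singularity at 0, so a convergent
Gamma integral dominates for every real `σ`. -/
theorem integrableOn_rpow_mul_exp_neg_sub_div (σ : ℝ) {Z : ℝ} (hZ : 0 < Z) :
    IntegrableOn (fun t : ℝ => t ^ (σ - 1) * Real.exp (-t - Z / t)) (Ioi 0) := by
  obtain ⟨n, hn⟩ := exists_nat_gt (-σ)
  have h1 := (Real.GammaIntegral_convergent (s := σ + n) (by linarith)).const_mul
    (n.factorial / Z ^ n)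
  refine h1.mono' ?_ ?_
  · refine ContinuousOn.aestronglyMeasurable ?_ measurableSet_Ioi
    intro t ht
    have ht' : t ≠ 0 := (mem_Ioi.1 ht).ne'
    exact ((Real.continuousAt_rpow_const _ _ (Or.inl ht')).mul
      (by fun_prop (disch := assumption))).continuousWithinAt
  · filter_upwards [self_mem_ae_restrict measurableSet_Ioi] with t ht
    have ht' : 0 < t := ht
    have h2 := Real.pow_div_factorial_le_exp (x := Z / t) (by positivity) n
    have h3 : Real.exp (-(Z / t)) ≤ n.factorial / Z ^ n * t ^ n := by
      rw [Real.exp_neg, inv_le_comm₀ (Real.exp_pos _) (by positivity)]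
      refine le_trans (le_of_eq ?_) h2
      rw [div_pow]
      field_simp
    rw [Real.norm_of_nonneg (by positivity), sub_eq_add_neg (-t), Real.exp_add,
      show σ + n - 1 = σ - 1 + n by ring, Real.rpow_add ht', Real.rpow_natCast]
    calc t ^ (σ - 1) * (Real.exp (-t) * Real.exp (-(Z / t)))
        ≤ t ^ (σ - 1) * (Real.exp (-t) * (n.factorial / Z ^ n * t ^ n)) := by gcongr
      _ = _ := by ring

/-- The Macdonald function in Mellin form, `2 Z^(w/2) K_w(2 √Z)`. -/
def macdonald (w : ℂ) (Z : ℝ) : ℂ :=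
  mellin (fun t : ℝ => ((Real.exp (-t - Z / t) : ℝ) : ℂ)) w

theorem norm_macdonald_integrand (w : ℂ) (Z : ℝ) {t : ℝ} (ht : 0 < t) :
    ‖(t : ℂ) ^ (w - 1) • ((Real.exp (-t - Z / t) : ℝ) : ℂ)‖ =
      t ^ (w.re - 1) * Real.exp (-t - Z / t) := by
  rw [norm_smul, Complex.norm_cpow_eq_rpow_re_of_pos ht, Complex.norm_real,
    Real.norm_of_nonneg (Real.exp_pos _).le]
  simp

theorem aestronglyMeasurable_macdonald_integrand (w : ℂ) (Z : ℝ) :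
    AEStronglyMeasurable (fun t : ℝ => (t : ℂ) ^ (w - 1) • ((Real.exp (-t - Z / t) : ℝ) : ℂ))
      (volume.restrict (Ioi 0)) := by
  refine ContinuousOn.aestronglyMeasurable ?_ measurableSet_Ioi
  simp only [smul_eq_mul]
  intro t ht
  have ht' : t ≠ 0 := (mem_Ioi.1 ht).ne'
  refine ContinuousAt.continuousWithinAt (ContinuousAt.mul ?_ ?_)
  · exact Complex.continuousAt_ofReal_cpow_const _ _ (Or.inr ht')
  · exact Complex.continuous_ofReal.continuousAt.comp (by fun_prop (disch := assumption))

theorem mellinConvergent_macdonald (w : ℂ) {Z : ℝ} (hZ : 0 < Z) :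
    MellinConvergent (fun t : ℝ => ((Real.exp (-t - Z / t) : ℝ) : ℂ)) w := by
  refine (integrableOn_rpow_mul_exp_neg_sub_div w.re hZ).mono'
    (aestronglyMeasurable_macdonald_integrand w Z) ?_
  filter_upwards [self_mem_ae_restrict measurableSet_Ioi] with t ht
  exact (norm_macdonald_integrand w Z ht).le

theorem hasDerivAt_macdonald (w : ℂ) {Z : ℝ} (hZ : 0 < Z) :
    HasDerivAt (macdonald w) (-macdonald (w - 1) Z) Z := by
  have h := hasDerivAt_integral_of_dominated_loc_of_deriv_le (𝕜 := ℝ)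
    -- On parameters above `Z / 2`, the exponential is at most its value at `Z / 2`, which keeps the
    -- majorant integrable at `t = 0`.
    (μ := volume.restrict (Ioi (0 : ℝ))) (s := Ioi (Z / 2)) (x₀ := Z)
    (F := fun Z t => (t : ℂ) ^ (w - 1) • ((Real.exp (-t - Z / t) : ℝ) : ℂ))
    (F' := fun Z t => -((t : ℂ) ^ (w - 1 - 1) • ((Real.exp (-t - Z / t) : ℝ) : ℂ)))
    (bound := fun t => t ^ ((w - 1).re - 1) * Real.exp (-t - Z / 2 / t))
    (Ioi_mem_nhds (by linarith))
    (Eventually.of_forall fun Z => aestronglyMeasurable_macdonald_integrand w Z)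
    (mellinConvergent_macdonald w hZ)
    (aestronglyMeasurable_macdonald_integrand (w - 1) Z).neg ?_
    (integrableOn_rpow_mul_exp_neg_sub_div _ (by positivity)) ?_
  · have h2 := h.2
    rw [integral_neg] at h2
    exact h2
  · filter_upwards [self_mem_ae_restrict measurableSet_Ioi] with t ht x hx
    have ht' : 0 < t := ht
    have hx' : Z / 2 < x := hx
    rw [norm_neg, norm_macdonald_integrand _ _ ht]
    gcongr
  · filter_upwards [self_mem_ae_restrict measurableSet_Ioi] with t ht x _
    have ht' : 0 < t := ht
    have ht'' : (t : ℂ) ≠ 0 := by exact_mod_cast ht'.ne'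
    have h1 : HasDerivAt (fun x : ℝ => Real.exp (-t - x / t))
        (Real.exp (-t - x / t) * -(1 / t)) x :=
      (((hasDerivAt_id x).div_const t).const_sub (-t)).exp
    convert! (h1.ofReal_comp).const_mul ((t : ℂ) ^ (w - 1)) using 1
    rw [Complex.cpow_sub _ _ ht'', Complex.cpow_one, smul_eq_mul]
    push_cast
    field_simp

/-- The exponent `-t - Z/t` is invariant under `t ↦ Z/t`. -/
theorem macdonald_neg (w : ℂ) {Z : ℝ} (hZ : 0 < Z) :
    macdonald (-w) Z = (Z : ℂ) ^ (-w) * macdonald w Z := by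
  unfold macdonald
  rw [← smul_eq_mul, ← mellin_comp_mul_left _ _ hZ, ← mellin_comp_inv]
  congr 1
  ext t
  rcases eq_or_ne t 0 with rfl | ht
  · simp
  · congr 2
    field_simp
    ring

theorem tendsto_macdonald {w : ℂ} (hw : 0 < w.re) :
    Tendsto (macdonald w) (𝓝[>] 0) (𝓝 (Complex.Gamma w)) := by
  have h0 : Complex.Gamma w = ∫ t : ℝ in Ioi 0, (t : ℂ) ^ (w - 1) • ((Real.exp (-t) : ℝ) : ℂ) := by
    rw [Complex.Gamma_eq_integral hw, Complex.GammaIntegral_eq_mellin]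
    rfl
  rw [h0]
  refine tendsto_integral_filter_of_dominated_convergence
    (fun t => Real.exp (-t) * t ^ (w.re - 1))
    (Eventually.of_forall fun Z => aestronglyMeasurable_macdonald_integrand w Z) ?_
    (Real.GammaIntegral_convergent hw) ?_
  · filter_upwards [self_mem_nhdsWithin] with Z hZ
    have hZ' : 0 < Z := hZ
    filter_upwards [self_mem_ae_restrict measurableSet_Ioi] with t ht
    have ht' : 0 < t := ht
    rw [norm_macdonald_integrand _ _ ht, mul_comm]
    gcongr
    have : 0 < Z / t := by positivity
    linarith
  · refine Eventually.of_forall fun t => Tendsto.const_smul ?_ _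
    have : Continuous fun Z : ℝ => ((Real.exp (-t - Z / t) : ℝ) : ℂ) := by fun_prop
    have h1 := this.tendsto 0
    rw [zero_div, sub_zero] at h1
    exact h1.mono_left nhdsWithin_le_nhds

/-- The recurrence `clifford_eq` makes this solution pass from `w` to `w - 1` under differentiation,
as `clifford (-w)` does too. -/
theorem hasDerivAt_cpow_mul_clifford (w : ℂ) {Z : ℝ} (hZ : 0 < Z) :
    HasDerivAt (fun Z : ℝ => (Z : ℂ) ^ w * clifford w Z)
      ((Z : ℂ) ^ (w - 1) * clifford (w - 1) Z) Z := by
  have hZ' : (Z : ℂ) ≠ 0 := by exact_mod_cast hZ.ne'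
  have h3 : HasDerivAt (fun Z : ℝ => (Z : ℂ) ^ w) (w * (Z : ℂ) ^ (w - 1)) Z := by
    have := ((hasDerivAt_id (Z : ℂ)).cpow_const (c := w)
      (Or.inl (by simpa using hZ))).comp_ofReal
    simpa using this
  convert! h3.mul (hasDerivAt_clifford w Z).comp_ofReal using 1
  rw [clifford_eq (w - 1), sub_add_cancel, show w - 1 + 2 = w + 1 by ring,
    Complex.cpow_sub _ _ hZ', Complex.cpow_one]
  field_simp

/-- The formula `K = (π/2) (I_{-w} - I_w) / sin πw`. -/
theorem macdonald_eq {w : ℂ} (hw : ∀ n : ℤ, w ≠ n) {Z : ℝ} (hZ : 0 < Z) :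
    macdonald w Z = Real.pi / Complex.sin (Real.pi * w) *
      (clifford (-w) Z - (Z : ℂ) ^ w * clifford w Z) := by
  rw [← sub_eq_zero]
  refine macdonald_family_eq_zero (D := fun w Z => macdonald w Z -
    Real.pi / Complex.sin (Real.pi * w) * (clifford (-w) Z - (Z : ℂ) ^ w * clifford w Z))
    ?_ ?_ ?_ hw hZ
  · intro w hw Z hZ
    refine ((hasDerivAt_macdonald w hZ).sub (((hasDerivAt_clifford (-w) Z).comp_ofReal.sub
      (hasDerivAt_cpow_mul_clifford w hZ)).const_mul _)).congr_deriv ?_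
    -- The sign change of `sin πw` under `w ↦ w - 1` supplies the minus sign of the derivation law.
    rw [mul_sub (Real.pi : ℂ), mul_one, Complex.sin_sub_pi, neg_sub w 1, ← neg_add_eq_sub w 1]
    ring
  · intro w hw Z hZ
    have hZ' : (Z : ℂ) ≠ 0 := by exact_mod_cast hZ.ne'
    have h1 : (Z : ℂ) ^ (-w) * (Z : ℂ) ^ w = 1 := by
      rw [← Complex.cpow_add _ _ hZ', neg_add_cancel, Complex.cpow_zero]
    rw [macdonald_neg w hZ, mul_neg, Complex.sin_neg, neg_neg, div_neg]
    linear_combination -(Real.pi / Complex.sin (Real.pi * w) * clifford w Z) * h1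
  · intro w hw hre
    have h1 : Tendsto (fun Z : ℝ => (Z : ℂ) ^ w) (𝓝[>] 0) (𝓝 0) := by
      have := (Complex.continuousAt_ofReal_cpow_const 0 w (Or.inl hre)).tendsto
      rw [Complex.ofReal_zero, Complex.zero_cpow (by rintro rfl; simp at hre)] at this
      exact this.mono_left nhdsWithin_le_nhds
    have h2 : ∀ μ : ℂ, Tendsto (fun Z : ℝ => clifford μ Z) (𝓝[>] 0)
        (𝓝 ((Complex.Gamma (μ + 1))⁻¹)) := fun μ => by
      have := ((continuous_clifford μ).comp Complex.continuous_ofReal).tendsto 0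
      have h0 : clifford μ 0 = (Complex.Gamma (μ + 1))⁻¹ := by
        unfold clifford
        rw [tsum_eq_single 0 (fun k hk => by simp [hk])]
        simp
      simp only [Function.comp, Complex.ofReal_zero, h0] at this
      exact this.mono_left nhdsWithin_le_nhds
    have h3 := (tendsto_macdonald hre).sub (((h2 (-w)).sub (h1.mul (h2 w))).const_mul
      (Real.pi / Complex.sin (Real.pi * w)))
    -- The reflection formula: `π / sin πw = Γ(w) Γ(1-w)`, so the limits at the origin cancel.
    have h4 : Complex.Gamma w - Real.pi / Complex.sin (Real.pi * w) *
        ((Complex.Gamma (-w + 1))⁻¹ - 0 * (Complex.Gamma (w + 1))⁻¹) = 0 := by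
      rw [zero_mul, sub_zero, ← Complex.Gamma_mul_Gamma_one_sub, neg_add_eq_sub,
        mul_assoc, mul_inv_cancel₀, mul_one, sub_self]
      refine Complex.Gamma_ne_zero fun m hm => hw (m + 1) ?_
      push_cast
      linear_combination -hm
    rwa [h4] at h3

/-- Substituting `t = X y²` in the Macdonald integral with `Z = X²`; the value is `K_μ(2X)`. -/
theorem mellin_exp_neg_mul_sq_add_inv_sq {μ : ℂ} (hμ : ∀ n : ℤ, μ ≠ n) {X : ℝ} (hX : 0 < X) :
    HasMellin (fun y : ℝ => ((Real.exp (-(X * (y ^ 2 + (y ^ 2)⁻¹))) : ℝ) : ℂ)) (2 * μ)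
      (Real.pi / Complex.sin (Real.pi * μ) / 2 * ((X : ℂ) ^ (-μ) * clifford (-μ) ((X : ℂ) ^ 2) -
        (X : ℂ) ^ μ * clifford μ ((X : ℂ) ^ 2))) := by
  have hX' : (X : ℂ) ≠ 0 := by exact_mod_cast hX.ne'
  set f : ℝ → ℂ := fun t => ((Real.exp (-t - X ^ 2 / t) : ℝ) : ℂ) with hf
  set g : ℝ → ℂ := fun t => f (X * t) with hg
  have e : (fun y : ℝ => ((Real.exp (-(X * (y ^ 2 + (y ^ 2)⁻¹))) : ℝ) : ℂ)) =
      fun y => g (y ^ (2 : ℝ)) := by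
    ext y
    simp only [Real.rpow_two, hg, hf]
    congr 2
    rcases eq_or_ne y 0 with rfl | hy
    · simp
    · field_simp
      ring
  have hs : 2 * μ / ((2 : ℝ) : ℂ) = μ := by push_cast; field_simp
  rw [e]
  constructor
  · rw [MellinConvergent.comp_rpow (f := g) two_ne_zero, hs, MellinConvergent.comp_mul_left hX]
    exact mellinConvergent_macdonald μ (by positivity)
  · rw [mellin_comp_rpow g, hs, mellin_comp_mul_left _ _ hX]
    have := macdonald_eq hμ (Z := X ^ 2) (by positivity)
    rw [macdonald] at this
    rw [this]
    have h1 : (((X ^ 2 : ℝ) : ℂ)) ^ μ = (X : ℂ) ^ μ * (X : ℂ) ^ μ := by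
      rw [pow_two, Complex.ofReal_mul, Complex.mul_cpow_ofReal_nonneg hX.le hX.le]
    have h2 : (X : ℂ) ^ (-μ) * (X : ℂ) ^ μ = 1 := by
      rw [← Complex.cpow_add _ _ hX', neg_add_cancel, Complex.cpow_zero]
    rw [h1, abs_two, Complex.real_smul, smul_eq_mul]
    push_cast
    linear_combination -(Real.pi / Complex.sin (Real.pi * μ) / 2 *
      (X : ℂ) ^ μ * clifford μ ((X : ℂ) ^ 2)) * h2

/-! ### Decay of Bessel functions of integral order -/

theorem hasDerivAt_re_clifford (n : ℕ) (x : ℝ) :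
    HasDerivAt (fun x : ℝ => (clifford n ((-(x / 2) ^ 2 : ℝ) : ℂ)).re)
      (-(x / 2) * (clifford (n + 1 : ℕ) ((-(x / 2) ^ 2 : ℝ) : ℂ)).re) x := by
  have h1 : HasDerivAt (fun Z : ℝ => (clifford n Z).re)
      (clifford (n + 1 : ℕ) ((-(x / 2) ^ 2 : ℝ) : ℂ)).re (-(x / 2) ^ 2) := by
    have := (hasDerivAt_clifford n ((-(x / 2) ^ 2 : ℝ) : ℂ)).real_of_complex
    rwa [Nat.cast_succ]
  have h2 : HasDerivAt (fun x : ℝ => -(x / 2) ^ 2) (-(x / 2)) x := by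
    convert! (((hasDerivAt_id x).div_const 2).pow 2).neg using 1
    simp only [id]
    norm_num
    ring
  convert! h1.comp x h2 using 1
  ring

theorem re_clifford_eq (n : ℕ) (Z : ℝ) :
    (clifford n Z).re =
      (n + 1) * (clifford (n + 1 : ℕ) Z).re + Z * (clifford (n + 2 : ℕ) Z).re := by
  have h := congrArg Complex.re (clifford_eq n Z)
  have h1 : ((n : ℂ) + 1) = ((n + 1 : ℕ) : ℂ) := by push_cast; ring
  have h2 : ((n : ℂ) + 2) = ((n + 2 : ℕ) : ℂ) := by push_cast; ring
  rw [h1, h2, Complex.add_re, Complex.re_ofReal_mul, Complex.mul_re, Complex.natCast_im, zero_mul,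
    sub_zero, Complex.natCast_re] at h
  rw [h]
  push_cast
  ring

/-- `J_n` decays like `x ^ (-1/2)`, uniformly on the half line. -/
theorem exists_pow_four_besselJ_le (n : ℕ) : ∃ C : ℝ, 0 ≤ C ∧ ∀ x : ℝ, 0 ≤ x →
    ((x / 2) ^ n * (clifford n ((-(x / 2) ^ 2 : ℝ) : ℂ)).re) ^ 4 * (1 + x ^ 2) ≤ C := by
  set c : ℕ → ℝ → ℝ := fun n x => (clifford n ((-(x / 2) ^ 2 : ℝ) : ℂ)).re with hc
  set j : ℝ → ℝ := fun x => (x / 2) ^ n * c n x with hj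
  set k : ℝ → ℝ := fun x => (x / 2) ^ (n + 1) * c (n + 1) x with hk
  have dc : ∀ n x, HasDerivAt (c n) (-(x / 2) * c (n + 1) x) x := hasDerivAt_re_clifford
  have dp : ∀ (n : ℕ) (x : ℝ), x ≠ 0 →
      HasDerivAt (fun x : ℝ => (x / 2) ^ n) (n / x * (x / 2) ^ n) x := by
    intro n x hx
    convert! ((hasDerivAt_id x).div_const 2).pow n using 1
    rcases n with _ | n
    · simp
    · simp only [id, Nat.add_sub_cancel, pow_succ]
      field_simp
  have dj : ∀ x, x ≠ 0 → HasDerivAt j (n / x * j x - k x) x := by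
    intro x hx
    refine ((dp n x hx).mul (dc n x)).congr_deriv ?_
    simp only [hj, hk, pow_succ]
    ring
  have dk : ∀ x, x ≠ 0 → HasDerivAt k (j x - (n + 1) / x * k x) x := by
    intro x hx
    refine ((dp (n + 1) x hx).mul (dc (n + 1) x)).congr_deriv ?_
    have h := re_clifford_eq n (-(x / 2) ^ 2)
    have h' : c n x = (n + 1) * c (n + 1) x + -(x / 2) ^ 2 * c (n + 2) x := h
    simp only [hj, hk, h', pow_succ]
    push_cast
    field_simp
    ring
  set m : ℝ := 2 * n + 1 with hm
  have hm1 : 1 ≤ m := by rw [hm]; linarith [(Nat.cast_nonneg n : (0 : ℝ) ≤ n)]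
  -- Here `j = J_n` and `k = J_{n+1}`. The derivative of `x (j² + k²)` is `m (j² - k²)`; subtracting
  -- `m j k` removes this and leaves only `m j k / x`.
  set E : ℝ → ℝ := fun x => x * (j x ^ 2 + k x ^ 2) - m * (j x * k x) with hE
  have dE : ∀ x, x ≠ 0 → HasDerivAt E (m / x * (j x * k x)) x := by
    intro x hx
    have h1 := (dj x hx).pow 2
    have h2 := (dk x hx).pow 2
    refine (((hasDerivAt_id x).mul (h1.add h2)).sub
      (((dj x hx).mul (dk x hx)).const_mul m)).congr_deriv ?_
    simp only [id, Pi.pow_apply, Pi.add_apply, hm]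
    field_simp
    norm_num
    ring
  have lowE : ∀ x, m ≤ x → x / 2 * (j x ^ 2 + k x ^ 2) ≤ E x := by
    intro x hx
    have h1 : j x * k x ≤ (j x ^ 2 + k x ^ 2) / 2 := by nlinarith [sq_nonneg (j x - k x)]
    have h3 : m * (j x * k x) ≤ m * ((j x ^ 2 + k x ^ 2) / 2) :=
      mul_le_mul_of_nonneg_left h1 (by linarith)
    have h4 : m * ((j x ^ 2 + k x ^ 2) / 2) ≤ x * ((j x ^ 2 + k x ^ 2) / 2) :=
      mul_le_mul_of_nonneg_right hx (by positivity)
    simp only [hE]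
    linarith
  have dW : ∀ x, x ≠ 0 → HasDerivAt (fun x => E x * Real.exp (m / x))
      (m / x * (j x * k x) * Real.exp (m / x) + E x * (Real.exp (m / x) * (-m / x ^ 2))) x := by
    intro x hx
    refine (dE x hx).mul (HasDerivAt.exp ?_)
    convert! (hasDerivAt_inv hx).const_mul m using 1
    ring
  -- The factor `exp(m/x)` absorbs the remaining derivative, because `x j k ≤ E` for `x ≥ m`. Hence
  -- `E` is bounded there and `x j²` with it.
  have anti : AntitoneOn (fun x => E x * Real.exp (m / x)) (Ici m) := by
    have pos : ∀ x ∈ Ici m, x ≠ 0 := fun x hx => by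
      have : m ≤ x := hx
      linarith
    refine antitoneOn_of_deriv_nonpos (convex_Ici m)
      (fun x hx => (dW x (pos x hx)).continuousAt.continuousWithinAt)
      (fun x hx => (dW x (pos x (interior_subset hx))).differentiableAt.differentiableWithinAt)
      (fun x hx => ?_)
    have hx' := interior_subset hx
    have hxm : m ≤ x := hx'
    have hx0 : 0 < x := by linarith
    rw [(dW x (pos x hx')).deriv]
    have h1 : j x * k x ≤ (j x ^ 2 + k x ^ 2) / 2 := by nlinarith [sq_nonneg (j x - k x)]
    have h2 : x * (j x * k x) ≤ E x := by
      refine le_trans ?_ (lowE x hxm)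
      nlinarith
    have h3 : m / x * (j x * k x) * Real.exp (m / x) + E x * (Real.exp (m / x) * (-m / x ^ 2)) =
        -(m / x ^ 2 * Real.exp (m / x)) * (E x - x * (j x * k x)) := by
      field_simp
      ring
    rw [h3, neg_mul]
    have : 0 ≤ m / x ^ 2 * Real.exp (m / x) := by positivity
    exact neg_nonpos.2 (mul_nonneg this (by linarith))
  set M : ℝ := E m * Real.exp (m / m) with hM
  have upE : ∀ x, m ≤ x → E x ≤ M := by
    intro x hx
    have h1 := anti (mem_Ici.2 le_rfl) (mem_Ici.2 hx) hx
    have hx0 : 0 < x := by linarith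
    have h2 : 0 ≤ E x := le_trans (by positivity) (lowE x hx)
    have h3 : 1 ≤ Real.exp (m / x) := Real.one_le_exp (by positivity)
    calc E x ≤ E x * Real.exp (m / x) := le_mul_of_one_le_right h2 h3
      _ ≤ M := h1
  have cont : Continuous fun x => j x ^ 4 * (1 + x ^ 2) := by
    have : Continuous (c n) := continuous_iff_continuousAt.2 fun x => (dc n x).continuousAt
    simp only [hj]
    fun_prop
  obtain ⟨C, hC⟩ := (isCompact_Icc (a := (0 : ℝ)) (b := m)).exists_bound_of_continuousOn
    cont.continuousOn
  refine ⟨max C (8 * M ^ 2), le_max_of_le_right (by positivity), fun x hx => ?_⟩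
  change j x ^ 4 * (1 + x ^ 2) ≤ _
  rcases le_total x m with h | h
  · exact ((le_abs_self _).trans (hC x ⟨hx, h⟩)).trans (le_max_left _ _)
  · refine le_trans ?_ (le_max_right _ _)
    have h1 := (lowE x h).trans (upE x h)
    have hx1 : 1 ≤ x := hm1.trans h
    have h2 : x * j x ^ 2 ≤ 2 * M := by nlinarith [mul_nonneg hx (sq_nonneg (k x))]
    have h3 : (x * j x ^ 2) ^ 2 ≤ (2 * M) ^ 2 := pow_le_pow_left₀ (by positivity) h2 2
    have h4 : j x ^ 4 ≤ j x ^ 4 * x ^ 2 := le_mul_of_one_le_right (by positivity) (one_le_pow₀ hx1)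
    nlinarith

/-! ### Uniqueness of the Laplace transform -/

/-- A continuous function on the half line whose Laplace transform vanishes is zero. -/
theorem eq_zero_of_laplace_eq_zero {G : ℝ → ℂ} (hG : ContinuousOn G (Ioi 0))
    (hInt : IntegrableOn (fun t => Real.exp (-t) • G t) (Ioi 0))
    (h : ∀ n : ℕ, ∫ t in Ioi 0, Real.exp (-((n + 1 : ℕ) : ℝ) * t) • G t = 0) {t : ℝ} (ht : 0 < t) :
    G t = 0 := by
  -- In the variable `q = exp(-t)`, the hypothesis says that every polynomial moment vanishes;
  -- Weierstrass approximation extends this to test functions.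
  have poly : ∀ p : Polynomial ℝ,
      IntegrableOn (fun t => p.eval (Real.exp (-t)) • (Real.exp (-t) • G t)) (Ioi 0) ∧
      ∫ t in Ioi 0, p.eval (Real.exp (-t)) • (Real.exp (-t) • G t) = 0 := by
    intro p
    induction p using Polynomial.induction_on' with
    | add p q hp hq =>
      simp only [Polynomial.eval_add, add_smul]
      exact ⟨hp.1.add hq.1, by rw [integral_add hp.1 hq.1, hp.2, hq.2, add_zero]⟩
    | monomial n a =>
      simp only [Polynomial.eval_monomial]
      constructor
      · refine hInt.bdd_smul (φ := fun t => a * Real.exp (-t) ^ n) |a|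
          (Continuous.aestronglyMeasurable (by fun_prop)) ?_
        filter_upwards [self_mem_ae_restrict measurableSet_Ioi] with t ht
        have ht' : 0 < t := ht
        rw [norm_mul, Real.norm_eq_abs, norm_pow, Real.norm_of_nonneg (Real.exp_pos _).le]
        exact mul_le_of_le_one_right (abs_nonneg a)
          (pow_le_one₀ (Real.exp_pos _).le (Real.exp_le_one_iff.2 (by linarith)))
      · have : ∀ t : ℝ, (a * Real.exp (-t) ^ n) • (Real.exp (-t) • G t) =
            a • (Real.exp (-((n + 1 : ℕ) : ℝ) * t) • G t) := by
          intro t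
          rw [smul_smul, smul_smul, ← Real.exp_nat_mul, mul_assoc, ← Real.exp_add]
          congr 3
          push_cast
          ring
        simp only [this]
        rw [integral_smul, h n, smul_zero]
  have hloc : LocallyIntegrableOn G (Ioi 0) := hG.locallyIntegrableOn measurableSet_Ioi
  have hae := isOpen_Ioi.ae_eq_zero_of_integral_contDiff_smul_eq_zero hloc (μ := volume) (by
    intro g hg hgc hgs
    set ψ : ℝ → ℝ := fun t => g t * Real.exp t with hψ
    have hψc : Continuous ψ := hg.continuous.mul Real.continuous_exp
    have g0 : g 0 = 0 := by
      by_contra hne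
      have := hgs (subset_tsupport g hne)
      exact lt_irrefl _ (mem_Ioi.1 this)
    have hφ : Continuous fun q : ℝ => ψ (-Real.log q) := by
      refine continuous_iff_continuousAt.2 fun q => ?_
      rcases eq_or_ne q 0 with rfl | hq
      · rw [continuousAt_iff_punctured_nhds]
        -- The default `Real.log 0 = 0` gives the value `ψ 0 = 0`. It agrees with the limit at `q =
        -- 0`, since `ψ` vanishes for large `t`.
        have h0 : ψ (-Real.log 0) = 0 := by simp [hψ, g0]
        rw [h0]
        obtain ⟨b, hb⟩ := hgc.isCompact.bddAbove
        have h1 : ∀ᶠ t in atTop, ψ t = 0 := by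
          filter_upwards [eventually_gt_atTop b] with t ht
          have : g t = 0 := by
            by_contra hne
            exact (not_lt.2 (hb (subset_tsupport g hne))) ht
          simp [hψ, this]
        exact tendsto_const_nhds.congr' (((tendsto_neg_atBot_atTop.comp
          Real.tendsto_log_nhdsNE_zero).eventually h1).mono fun q hq => hq.symm)
      · exact hψc.continuousAt.comp (Real.continuousAt_log hq).neg
    have e1 : ∫ t, g t • G t = ∫ t in Ioi 0, ψ t • (Real.exp (-t) • G t) := by
      rw [← setIntegral_eq_integral_of_forall_compl_eq_zero (s := Ioi 0)]
      · congr 1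
        ext t
        rw [smul_smul, hψ, mul_assoc, ← Real.exp_add, add_neg_cancel, Real.exp_zero, mul_one]
      · intro t ht
        have : g t = 0 := by
          by_contra hne
          exact ht (hgs (subset_tsupport g hne))
        rw [this, zero_smul]
    rw [e1, ← norm_le_zero_iff]
    set K : ℝ := ∫ t in Ioi 0, ‖Real.exp (-t) • G t‖ with hK
    have hK0 : 0 ≤ K := integral_nonneg fun _ => norm_nonneg _
    refine le_of_forall_pos_le_add fun ε hε => ?_
    -- Dividing by `K + 1` rather than `K` covers the case `K = 0`.
    obtain ⟨p, hp⟩ := exists_polynomial_near_of_continuousOn 0 1 (fun q => ψ (-Real.log q))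
      hφ.continuousOn (ε / (K + 1)) (by positivity)
    have near : ∀ t ∈ Ioi (0 : ℝ), ‖ψ t - p.eval (Real.exp (-t))‖ ≤ ε / (K + 1) := by
      intro t ht
      have ht' : 0 < t := ht
      have := hp (Real.exp (-t)) ⟨(Real.exp_pos _).le, Real.exp_le_one_iff.2 (by linarith)⟩
      rw [Real.log_exp, neg_neg] at this
      rw [norm_sub_rev]
      exact this.le
    have i1 : IntegrableOn
        (fun t => (ψ t - p.eval (Real.exp (-t))) • (Real.exp (-t) • G t)) (Ioi 0) := by
      refine hInt.bdd_smul
        (φ := fun t => ψ t - p.eval (Real.exp (-t))) (ε / (K + 1))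
        (Continuous.aestronglyMeasurable ?_) ?_
      · exact hψc.sub (p.continuous.comp (by fun_prop))
      · filter_upwards [self_mem_ae_restrict measurableSet_Ioi] with t ht using near t ht
    have e2 : ∫ t in Ioi 0, ψ t • (Real.exp (-t) • G t) =
        ∫ t in Ioi 0, (ψ t - p.eval (Real.exp (-t))) • (Real.exp (-t) • G t) := by
      rw [← add_zero (∫ t in Ioi 0, (ψ t - p.eval (Real.exp (-t))) • (Real.exp (-t) • G t)),
        ← (poly p).2, ← integral_add i1 (poly p).1]
      congr 1
      ext t
      rw [← add_smul, sub_add_cancel]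
    rw [e2, zero_add]
    calc ‖∫ t in Ioi 0, (ψ t - p.eval (Real.exp (-t))) • (Real.exp (-t) • G t)‖
        ≤ ∫ t in Ioi 0, ε / (K + 1) * ‖Real.exp (-t) • G t‖ := by
          refine norm_integral_le_of_norm_le (hInt.norm.const_mul _) ?_
          filter_upwards [self_mem_ae_restrict measurableSet_Ioi] with t ht
          rw [norm_smul (ψ t - _)]
          exact mul_le_mul_of_nonneg_right (near t ht) (norm_nonneg _)
      _ = ε * (K / (K + 1)) := by
          rw [integral_const_mul, ← hK]
          ring
      _ ≤ ε := mul_le_of_le_one_right hε.le ((div_le_one (by positivity)).2 (by linarith)))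
  have := Measure.eqOn_open_of_ae_eq (μ := volume) (g := fun _ => (0 : ℂ)) (U := Ioi 0) (f := G)
    ((ae_restrict_iff' measurableSet_Ioi).2 hae) isOpen_Ioi hG continuousOn_const
  exact this ht

/-! ### Termwise Laplace transformation -/

theorem integrable_of_summable_integral_norm {X ι : Type*} [MeasurableSpace X] {μ : Measure X}
    [Countable ι] {f : ι → X → ℂ} {F : X → ℂ} (hf : ∀ i, Integrable (f i) μ)
    (hsum : Summable fun i => ∫ x, ‖f i x‖ ∂μ) (hFm : AEStronglyMeasurable F μ)
    (hF : ∀ᵐ x ∂μ, HasSum (fun i => f i x) (F x)) : Integrable F μ := by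
  refine ⟨hFm, ?_⟩
  have h1 : ∫⁻ x, ‖F x‖ₑ ∂μ ≤ ∑' i, ∫⁻ x, ‖f i x‖ₑ ∂μ := by
    rw [← lintegral_tsum fun i => (hf i).1.enorm]
    refine lintegral_mono_ae (hF.mono fun x hx => ?_)
    rw [← hx.tsum_eq]
    exact enorm_tsum_le_tsum_enorm
  refine lt_of_le_of_lt h1 ?_
  have h2 : ∀ i, ∫⁻ x, ‖f i x‖ₑ ∂μ = ENNReal.ofReal (∫ x, ‖f i x‖ ∂μ) := fun i =>
    (ofReal_integral_norm_eq_lintegral_enorm (hf i)).symm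
  simp only [h2]
  exact hsum.tsum_ofReal_lt_top

/-- Termwise Laplace transformation of a generalized power series. -/
theorem hasSum_laplace {ι : Type*} [Countable ι] {b a : ι → ℂ} {F : ℝ → ℂ} {s : ℝ} (hs : 0 < s)
    (ha : ∀ i, 0 < (a i).re) (hFc : ContinuousOn F (Ioi 0))
    (hF : ∀ t : ℝ, 0 < t → HasSum (fun i => b i * (t : ℂ) ^ (a i - 1)) (F t))
    (hsum : Summable fun i => ‖b i‖ * ((1 / s) ^ (a i).re * Real.Gamma (a i).re)) :
    IntegrableOn (fun t => Real.exp (-s * t) • F t) (Ioi 0) ∧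
    HasSum (fun i => b i * ((1 / s : ℂ) ^ (a i) * Complex.Gamma (a i)))
      (∫ t in Ioi 0, Real.exp (-s * t) • F t) := by
  set f : ι → ℝ → ℂ := fun i t => b i * ((t : ℂ) ^ (a i - 1) * Complex.exp (-(s * t))) with hf
  have hnorm : ∀ i, ∀ t : ℝ, 0 < t →
      ‖f i t‖ = ‖b i‖ * (t ^ ((a i).re - 1) * Real.exp (-(s * t))) := by
    intro i t ht
    simp only [hf]
    rw [norm_mul, norm_mul, Complex.norm_cpow_eq_rpow_re_of_pos ht, Complex.norm_exp]
    simp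
  have hInt : ∀ i, IntegrableOn (f i) (Ioi 0) := by
    intro i
    have h1 := integrableOn_rpow_mul_exp_neg_mul_rpow (p := 1) (s := (a i).re - 1) (b := s)
      (by linarith [ha i]) one_pos hs
    refine (h1.const_mul ‖b i‖).mono' ?_ ?_
    · refine ContinuousOn.aestronglyMeasurable (fun t ht => ?_) measurableSet_Ioi
      have ht' : t ≠ 0 := (mem_Ioi.1 ht).ne'
      exact (continuousAt_const.mul ((Complex.continuousAt_ofReal_cpow_const _ _ (Or.inr ht')).mul
        (by fun_prop))).continuousWithinAt
    · filter_upwards [self_mem_ae_restrict measurableSet_Ioi] with t ht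
      rw [hnorm i t ht, Real.rpow_one, neg_mul]
  have hval : ∀ i, ∫ t in Ioi 0, ‖f i t‖ = ‖b i‖ * ((1 / s) ^ (a i).re * Real.Gamma (a i).re) := by
    intro i
    rw [setIntegral_congr_fun measurableSet_Ioi (hnorm i), integral_const_mul,
      Real.integral_rpow_mul_exp_neg_mul_Ioi (ha i) hs]
  have hFs : ∀ᵐ t ∂(volume.restrict (Ioi (0 : ℝ))),
      HasSum (fun i => f i t) (Real.exp (-s * t) • F t) := by
    filter_upwards [self_mem_ae_restrict measurableSet_Ioi] with t ht
    convert! (hF t ht).mul_left ((Real.exp (-s * t) : ℝ) : ℂ) using 1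
    ext i
    simp only [hf]
    push_cast
    rw [neg_mul]
    ring
  have hsum' : Summable fun i => ∫ t in Ioi 0, ‖f i t‖ := by
    simpa only [hval] using hsum
  constructor
  · refine integrable_of_summable_integral_norm hInt hsum' ?_ hFs
    refine ContinuousOn.aestronglyMeasurable ?_ measurableSet_Ioi
    have he : Continuous fun t : ℝ => Real.exp (-s * t) := by fun_prop
    exact he.continuousOn.smul hFc
  · have h1 := hasSum_integral_of_summable_integral_norm hInt hsum'
    rw [integral_congr_ae (hFs.mono fun t ht => ht.tsum_eq)] at h1
    convert! h1 using 1
    ext i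
    simp only [hf]
    rw [integral_const_mul, Complex.integral_cpow_mul_exp_neg_mul_Ioi (ha i) hs]

/-- The transform of `t^(n+k)` brings in `Γ(n+k+1)`, which cancels the Gamma factor of the
coefficient and leaves the exponential series. -/
theorem laplace_pow_mul_clifford (n : ℕ) (c : ℂ) {s : ℝ} (hs : 0 < s) :
    ∫ t : ℝ in Ioi 0, Real.exp (-s * t) • ((t : ℂ) ^ n * clifford n (-c * t)) =
      (1 / s : ℂ) ^ (n + 1) * Complex.exp (-c / s) := by
  have hs' : (s : ℂ) ≠ 0 := by exact_mod_cast hs.ne'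
  have hG : ∀ k : ℕ, Complex.Gamma ((n : ℂ) + k + 1) = ((n + k).factorial : ℂ) := fun k => by
    rw [← Complex.Gamma_nat_eq_factorial]; push_cast; rfl
  have h := (hasSum_laplace (ι := ℕ) (F := fun t : ℝ => (t : ℂ) ^ n * clifford n (-c * t))
    (b := fun k => (k.factorial : ℂ)⁻¹ * (Complex.Gamma (n + k + 1))⁻¹ * (-c) ^ k)
    (a := fun k => ((n + k + 1 : ℕ) : ℂ)) hs
    (fun k => by rw [Complex.natCast_re]; positivity)
    (by have := continuous_clifford n; fun_prop) ?_ ?_).2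
  · have h2 : HasSum (fun k : ℕ => (1 / s : ℂ) ^ (n + 1) * ((-c / s) ^ k / k.factorial))
        ((1 / s : ℂ) ^ (n + 1) * Complex.exp (-c / s)) := by
      rw [Complex.exp_eq_exp_ℂ]
      exact (NormedSpace.expSeries_div_hasSum_exp (-c / s : ℂ)).mul_left _
    refine h.unique ?_
    convert! h2 using 2 with k
    have h3 : ((n + k).factorial : ℂ) ≠ 0 := by exact_mod_cast (n + k).factorial_ne_zero
    have h4 : (k.factorial : ℂ) ≠ 0 := by exact_mod_cast k.factorial_ne_zero
    rw [Complex.cpow_natCast, Nat.cast_succ, Complex.Gamma_nat_eq_factorial, hG]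
    simp only [div_pow, one_pow, pow_add, pow_one]
    field_simp
  · intro t ht
    have ht' : (t : ℂ) ≠ 0 := by exact_mod_cast ht.ne'
    convert! (hasSum_clifford n (-c * t)).mul_left ((t : ℂ) ^ n) using 1
    ext k
    rw [Nat.cast_succ, add_sub_cancel_right, Complex.cpow_natCast, pow_add, mul_pow]
    ring
  · have h2 : Summable fun k : ℕ => (1 / s) ^ (n + 1) * ((‖c‖ / s) ^ k / k.factorial) :=
      (Real.summable_pow_div_factorial (‖c‖ / s)).mul_left _
    convert! h2 using 2 with k
    have h3 : ((n + k).factorial : ℝ) ≠ 0 := by exact_mod_cast (n + k).factorial_ne_zero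
    have h4 : (k.factorial : ℝ) ≠ 0 := by exact_mod_cast k.factorial_ne_zero
    rw [Complex.natCast_re, Real.rpow_natCast, Nat.cast_succ, Real.Gamma_nat_eq_factorial, hG,
      norm_mul, norm_mul, norm_inv, norm_inv, norm_pow, norm_neg, Complex.norm_natCast,
      Complex.norm_natCast]
    simp only [div_pow, one_pow, pow_add, pow_one]
    field_simp

/-! ### Laplace transform of a product of two Bessel functions -/

theorem Gamma_nat_add_le {ρ : ℝ} (hρ : -1 < ρ) :
    ∃ C : ℝ, 0 ≤ C ∧ ∀ m : ℕ, Real.Gamma (ρ + m + 1) ≤ C * 2 ^ m * m.factorial := by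
  obtain ⟨C, hC, h⟩ := exists_le_const_mul_two_pow
    (fun m : ℕ => Real.Gamma (ρ + m + 1) / m.factorial) (by
      filter_upwards [eventually_ge_atTop ⌈ρ⌉₊] with m hm
      have hm' : ρ ≤ m := Nat.ceil_le.1 hm
      have hpos : 0 < ρ + m + 1 := by linarith [(Nat.cast_nonneg m : (0 : ℝ) ≤ m)]
      rw [Nat.factorial_succ, show ρ + ((m + 1 : ℕ) : ℝ) + 1 = ρ + m + 1 + 1 by push_cast; ring,
        Real.Gamma_add_one hpos.ne', div_le_iff₀ (by positivity)]
      have hg := Real.Gamma_pos_of_pos hpos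
      have h1 : (0 : ℝ) < m.factorial := by positivity
      push_cast
      field_simp
      nlinarith)
  refine ⟨C, hC, fun m => ?_⟩
  have := h m
  rwa [div_le_iff₀ (by positivity)] at this

/-- Pascal's rule, in the form that drives the inductions of `hasSum_kummer` and
`hasSum_exp_mul_clifford`. -/
theorem sum_choose_succ_mul_pow (N : ℕ) (x : ℂ) (g : ℕ → ℂ) :
    ∑ i ∈ Finset.range (N + 1 + 1), ((N + 1).choose i : ℂ) * x ^ i * g i =
      ∑ i ∈ Finset.range (N + 1), (N.choose i : ℂ) * x ^ i * g i +
        x * ∑ i ∈ Finset.range (N + 1), (N.choose i : ℂ) * x ^ i * g (i + 1) := by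
  rw [Finset.sum_range_succ', Finset.mul_sum]
  have h1 : ∑ i ∈ Finset.range (N + 1), (N.choose i : ℂ) * x ^ i * g i =
      ∑ i ∈ Finset.range (N + 1), (N.choose (i + 1) : ℂ) * x ^ (i + 1) * g (i + 1) +
        (N.choose 0 : ℂ) * x ^ 0 * g 0 := by
    rw [← Finset.sum_range_succ' (fun i => (N.choose i : ℂ) * x ^ i * g i),
      Finset.sum_range_succ _ (N + 1), Nat.choose_succ_self]
    simp
  rw [h1, Nat.choose_zero_right, Nat.choose_zero_right, add_right_comm, ← Finset.sum_add_distrib]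
  congr 1
  refine Finset.sum_congr rfl fun i _ => ?_
  rw [Nat.choose_succ_succ, pow_succ]
  push_cast
  ring

/-- Kummer's transformation for a confluent series that terminates after multiplication by
the exponential. -/
theorem hasSum_kummer (N : ℕ) {α : ℂ} (hα : ∀ n : ℤ, α ≠ n) (x : ℂ) :
    HasSum (fun k : ℕ => x ^ k / k.factorial * (Complex.Gamma (α + N + k + 1) *
      (Complex.Gamma (α + k + 1))⁻¹ * (Complex.Gamma (α + N + 1))⁻¹))
      (Complex.exp x * ∑ i ∈ Finset.range (N + 1),
        (N.choose i : ℂ) * x ^ i * (Complex.Gamma (α + i + 1))⁻¹) := by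
  have hne : ∀ {α : ℂ}, (∀ n : ℤ, α ≠ n) → ∀ m : ℕ, Complex.Gamma (α + m + 1) ≠ 0 := by
    intro α hα m
    refine Complex.Gamma_ne_zero fun l hl => hα (-l - m - 1) ?_
    push_cast
    linear_combination hl
  induction N generalizing α with
  | zero =>
    have h : HasSum (fun k : ℕ => x ^ k / k.factorial * (Complex.Gamma (α + 1))⁻¹)
        (Complex.exp x * (Complex.Gamma (α + 1))⁻¹) := by
      rw [Complex.exp_eq_exp_ℂ]
      exact (NormedSpace.expSeries_div_hasSum_exp x).mul_right _
    convert! h using 1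
    · ext k
      rw [Nat.cast_zero, add_zero, mul_inv_cancel₀ (hne hα k), one_mul]
    · simp
  | succ N ih =>
    have hα1 : ∀ n : ℤ, α + 1 ≠ n := fun n hn => hα (n - 1) (by push_cast; rw [← hn]; ring)
    -- The term of index `k` for `(N + 1, α)` is the one for `(N, α)` plus `x` times the term of
    -- index `k - 1` for `(N, α + 1)`, which is `T (k - 1)`.
    set T : ℕ → ℂ := fun k => x ^ k / k.factorial * (Complex.Gamma (α + 1 + N + k + 1) *
      (Complex.Gamma (α + 1 + k + 1))⁻¹ * (Complex.Gamma (α + 1 + N + 1))⁻¹) with hT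
    have h2 : HasSum (fun k : ℕ => if k = 0 then 0 else x * T (k - 1))
        (x * (Complex.exp x * ∑ i ∈ Finset.range (N + 1),
          (N.choose i : ℂ) * x ^ i * (Complex.Gamma (α + 1 + i + 1))⁻¹)) := by
      refine (hasSum_nat_add_iff' 1).1 ?_
      simpa using (ih hα1).mul_left x
    have h3 := (ih hα).add h2
    rw [sum_choose_succ_mul_pow]
    convert! h3 using 1
    · ext k
      have g1 : Complex.Gamma (α + (N + 1 : ℕ) + k + 1) =
          (α + N + k + 1) * Complex.Gamma (α + N + k + 1) := by
        rw [show α + (N + 1 : ℕ) + k + 1 = α + N + k + 1 + 1 by push_cast; ring,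
          Complex.Gamma_add_one]
        have := hα (-N - k - 1)
        intro h
        apply this
        push_cast
        linear_combination h
      have g2 : Complex.Gamma (α + (N + 1 : ℕ) + 1) =
          (α + N + 1) * Complex.Gamma (α + N + 1) := by
        rw [show α + (N + 1 : ℕ) + 1 = α + N + 1 + 1 by push_cast; ring, Complex.Gamma_add_one]
        have := hα (-N - 1)
        intro h
        apply this
        push_cast
        linear_combination h
      have g3 : α + N + 1 ≠ 0 := by
        have := hα (-N - 1)
        intro h
        apply this
        push_cast
        linear_combination h
      have n1 := hne hα N
      have n2 := hne hα k
      rw [g1, g2]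
      rcases k with _ | k
      · simp only [Nat.cast_zero, add_zero, if_true]
        field_simp
      · have e1 : α + 1 + N + k + 1 = α + N + (k + 1 : ℕ) + 1 := by push_cast; ring
        have e2 : α + 1 + k + 1 = α + (k + 1 : ℕ) + 1 := by push_cast; ring
        have e3 : α + 1 + N + 1 = α + (N + 1 : ℕ) + 1 := by push_cast; ring
        have f1 : (k.factorial : ℂ) ≠ 0 := by exact_mod_cast k.factorial_ne_zero
        have f2 : (k : ℂ) + 1 ≠ 0 := by exact_mod_cast k.succ_ne_zero
        simp only [hT, Nat.succ_ne_zero, if_false, Nat.add_sub_cancel]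
        rw [e1, e2, e3, g2, Nat.factorial_succ, pow_succ]
        push_cast at n2 ⊢
        field_simp
        ring
    · rw [mul_add]
      have : ∀ i : ℕ, α + 1 + i + 1 = α + (i + 1 : ℕ) + 1 := fun i => by push_cast; ring
      simp only [this]
      ring

/-- For `n = 0` this is the Cauchy product of the series of `exp y` and of `clifford α (x * y)`;
Pascal's rule gives the induction. -/
theorem hasSum_exp_mul_clifford (n : ℕ) (α x y : ℂ) :
    HasSum (fun l : ℕ => y ^ l / l.factorial * ∑ i ∈ Finset.range (n + l + 1),
        ((n + l).choose i : ℂ) * x ^ i * (Complex.Gamma (α + i + 1))⁻¹)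
      (Complex.exp y * ∑ j ∈ Finset.range (n + 1),
        (n.choose j : ℂ) * x ^ j * clifford (α + j) (x * y)) := by
  induction n generalizing α with
  | zero =>
    have h1 : Summable fun l : ℕ => ‖y ^ l / (l.factorial : ℂ)‖ := by
      simpa using Real.summable_pow_div_factorial ‖y‖
    have h2 := hasSum_sum_range_mul_of_summable_norm h1 (summable_norm_clifford α (x * y))
    have h3 : ∑' l : ℕ, y ^ l / (l.factorial : ℂ) = Complex.exp y := by
      rw [Complex.exp_eq_exp_ℂ]
      exact (NormedSpace.expSeries_div_hasSum_exp y).tsum_eq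
    rw [h3, (hasSum_clifford α (x * y)).tsum_eq] at h2
    convert! h2 using 1
    · ext l
      rw [zero_add, Finset.mul_sum, ← Finset.sum_range_reflect]
      refine Finset.sum_congr rfl fun i hi => ?_
      have hi' : i ≤ l := Nat.lt_succ_iff.1 (Finset.mem_range.1 hi)
      have e : l + 1 - 1 - i = l - i := by omega
      rw [e, Nat.cast_choose ℂ (Nat.sub_le l i), Nat.sub_sub_self hi', mul_pow]
      have f1 : (l.factorial : ℂ) ≠ 0 := by exact_mod_cast l.factorial_ne_zero
      have f2 : (i.factorial : ℂ) ≠ 0 := by exact_mod_cast i.factorial_ne_zero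
      have f3 : ((l - i).factorial : ℂ) ≠ 0 := by exact_mod_cast (l - i).factorial_ne_zero
      have e2 : y ^ l = y ^ i * y ^ (l - i) := by rw [← pow_add, Nat.add_sub_cancel' hi']
      rw [e2]
      field_simp
    · simp
  | succ n ih =>
    have h := (ih α).add ((ih (α + 1)).mul_left x)
    rw [sum_choose_succ_mul_pow]
    convert! h using 1
    · ext l
      rw [show n + 1 + l = n + l + 1 by ring, sum_choose_succ_mul_pow]
      have : ∀ i : ℕ, α + 1 + i + 1 = α + (i + 1 : ℕ) + 1 := fun i => by push_cast; ring
      simp only [this]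
      ring
    · have : ∀ i : ℕ, α + 1 + i = α + (i + 1 : ℕ) := fun i => by push_cast; ring
      simp only [this]
      ring

theorem factorial_add_le (k l : ℕ) :
    ((k + l).factorial : ℝ) ≤ 2 ^ k * 2 ^ l * k.factorial * l.factorial := by
  have h1 := Nat.add_choose_mul_factorial_mul_factorial k l
  have h2 : (k + l).choose l ≤ 2 ^ (k + l) := Nat.choose_le_two_pow _ _
  rw [← h1, pow_add] at *
  exact_mod_cast Nat.mul_le_mul_right _ (Nat.mul_le_mul_right _ h2)

theorem hasSum_clifford_mul_clifford (μ ν x y : ℂ) :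
    HasSum (fun i : ℕ × ℕ =>
      ((i.1.factorial : ℂ)⁻¹ * (Complex.Gamma (μ + i.1 + 1))⁻¹ * x ^ i.1) *
      ((i.2.factorial : ℂ)⁻¹ * (Complex.Gamma (ν + i.2 + 1))⁻¹ * y ^ i.2))
      (clifford μ x * clifford ν y) := by
  have h := summable_mul_of_summable_norm (summable_norm_clifford μ x) (summable_norm_clifford ν y)
  convert! h.hasSum using 1
  rw [← tsum_mul_tsum_of_summable_norm (summable_norm_clifford μ x) (summable_norm_clifford ν y)]
  rfl

theorem summable_laplace_clifford_mul_clifford (α : ℂ) (n : ℕ)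
    (hre : -1 < (α + n).re) (a b : ℂ) {s : ℝ} (hs : 0 < s) :
    Summable fun i : ℕ × ℕ => ‖((i.1.factorial : ℂ)⁻¹ * (Complex.Gamma (α + n + i.1 + 1))⁻¹ * (-b) ^ i.1) *
    ((i.2.factorial : ℂ)⁻¹ * (Complex.Gamma (α + i.2 + 1))⁻¹ * (-a) ^ i.2)‖ *
      ((1 / s) ^ (α + n + 1 + ((i.1 + i.2 : ℕ) : ℂ)).re *
        Real.Gamma (α + n + 1 + ((i.1 + i.2 : ℕ) : ℂ)).re) := by
  set ρ : ℝ := (α + n).re with hρ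
  obtain ⟨C₁, hC₁, h1⟩ := norm_inv_Gamma_le (α + n)
  obtain ⟨C₂, hC₂, h2⟩ := norm_inv_Gamma_le α
  obtain ⟨C₃, hC₃, h3⟩ := Gamma_nat_add_le hre
  -- The 8 is `2 · 2 · 2`: one factor each from the bounds for `1/Γ`, for `Γ`, and for the factorial
  -- of `l + k`.
  have hsum : Summable fun i : ℕ × ℕ => C₁ * C₂ * C₃ * (1 / s) ^ (ρ + 1) *
      (((8 * ‖b‖ / s) ^ i.1 / i.1.factorial) * ((8 * ‖a‖ / s) ^ i.2 / i.2.factorial)) :=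
    ((Real.summable_pow_div_factorial _).mul_of_nonneg (Real.summable_pow_div_factorial _)
      (fun l => by positivity) (fun l => by positivity)).mul_left _
  refine Summable.of_nonneg_of_le (fun i => ?_) (fun i => ?_) hsum
  · have : 0 < (α + n + 1 + ((i.1 + i.2 : ℕ) : ℂ)).re := by
      have : (0 : ℝ) ≤ ((i.1 + i.2 : ℕ) : ℝ) := Nat.cast_nonneg _
      rw [Complex.add_re, Complex.add_re (α + n), Complex.natCast_re, Complex.one_re]
      linarith
    have := Real.Gamma_pos_of_pos this
    positivity
  · obtain ⟨l, k⟩ := i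
    have er : (α + n + 1 + ((l + k : ℕ) : ℂ)).re = ρ + 1 + ((l + k : ℕ) : ℝ) := by
      rw [Complex.add_re, Complex.add_re, Complex.natCast_re, Complex.one_re]
    have hg : Real.Gamma (ρ + 1 + ((l + k : ℕ) : ℝ)) ≤
        C₃ * (2 ^ l * 2 ^ k) * (2 ^ l * 2 ^ k * l.factorial * k.factorial) := by
      rw [show ρ + 1 + ((l + k : ℕ) : ℝ) = ρ + ((l + k : ℕ) : ℝ) + 1 by ring, ← pow_add]
      exact (h3 (l + k)).trans (mul_le_mul_of_nonneg_left
        ((factorial_add_le l k).trans_eq (by ring)) (by positivity))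
    have hg0 : 0 ≤ Real.Gamma (ρ + 1 + ((l + k : ℕ) : ℝ)) :=
      (Real.Gamma_pos_of_pos (by
        have : (0 : ℝ) ≤ ((l + k : ℕ) : ℝ) := Nat.cast_nonneg _
        linarith)).le
    have h1' := h1 l
    have h2' := h2 k
    simp only [er]
    rw [Real.rpow_add (by positivity), Real.rpow_natCast]
    simp only [norm_mul, norm_inv, norm_pow, norm_neg, Complex.norm_natCast]
    rw [norm_inv] at h1' h2'
    calc _ ≤ ((l.factorial : ℝ)⁻¹ * (C₁ * 2 ^ l / l.factorial) * ‖b‖ ^ l *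
          ((k.factorial : ℝ)⁻¹ * (C₂ * 2 ^ k / k.factorial) * ‖a‖ ^ k)) *
          ((1 / s) ^ (ρ + 1) * (1 / s) ^ (l + k) *
            (C₃ * (2 ^ l * 2 ^ k) * (2 ^ l * 2 ^ k * l.factorial * k.factorial))) := by
          gcongr
      _ = _ := by
          have e8 : ∀ m : ℕ, (8 : ℝ) ^ m = 2 ^ m * 2 ^ m * 2 ^ m := fun m => by
            rw [← mul_pow, ← mul_pow]; norm_num
          simp only [div_pow, mul_pow, one_pow, pow_add, e8]
          field_simp

/-- Weber's second exponential integral for orders that differ by `n`. In the double series, the sum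
over the powers of `a` is Kummer's transformation with `N = n + l`, and the remaining sum over `l`
is `hasSum_exp_mul_clifford`. -/
theorem laplace_clifford_mul_clifford {α : ℂ} (hα : ∀ n : ℤ, α ≠ n) (n : ℕ)
    (hre : -1 < (α + n).re) (a b : ℂ) {s : ℝ} (hs : 0 < s) :
    IntegrableOn (fun t : ℝ => Real.exp (-s * t) •
      ((t : ℂ) ^ (α + n) * (clifford (α + n) (-b * t) * clifford α (-a * t)))) (Ioi 0) ∧
    ∫ t : ℝ in Ioi 0, Real.exp (-s * t) •
      ((t : ℂ) ^ (α + n) * (clifford (α + n) (-b * t) * clifford α (-a * t))) =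
      (1 / s : ℂ) ^ (α + n + 1) * (Complex.exp (-a / s) * (Complex.exp (-b / s) *
        ∑ j ∈ Finset.range (n + 1),
          (n.choose j : ℂ) * (-a / s) ^ j * clifford (α + j) (-a / s * (-b / s)))) := by
  have hs' : (s : ℂ) ≠ 0 := by exact_mod_cast hs.ne'
  have hs1 : (1 / s : ℂ) ≠ 0 := one_div_ne_zero hs'
  set β : ℕ × ℕ → ℂ := fun i =>
    ((i.1.factorial : ℂ)⁻¹ * (Complex.Gamma (α + n + i.1 + 1))⁻¹ * (-b) ^ i.1) *
    ((i.2.factorial : ℂ)⁻¹ * (Complex.Gamma (α + i.2 + 1))⁻¹ * (-a) ^ i.2) with hβ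
  have key := hasSum_laplace (ι := ℕ × ℕ)
    (F := fun t : ℝ => (t : ℂ) ^ (α + n) * (clifford (α + n) (-b * t) * clifford α (-a * t)))
    (b := β) (a := fun i => α + n + 1 + ((i.1 + i.2 : ℕ) : ℂ)) hs
    (fun i => by
      have : (0 : ℝ) ≤ ((i.1 + i.2 : ℕ) : ℝ) := Nat.cast_nonneg _
      simp only [Complex.add_re, Complex.natCast_re, Complex.one_re] at hre ⊢
      linarith)
    (by
      have h1 := continuous_clifford (α + n)
      have h2 := continuous_clifford α
      refine ContinuousOn.mul (fun t ht => ?_) (by fun_prop)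
      exact (Complex.continuousAt_ofReal_cpow_const _ _
        (Or.inr (mem_Ioi.1 ht).ne')).continuousWithinAt)
    ?_ (summable_laplace_clifford_mul_clifford α n hre a b hs)
  · obtain ⟨hI, hS⟩ := key
    refine ⟨hI, ?_⟩
    have h1 : ∀ l : ℕ, HasSum (fun k : ℕ => β (l, k) *
        ((1 / s : ℂ) ^ (α + n + 1 + ((l + k : ℕ) : ℂ)) *
          Complex.Gamma (α + n + 1 + ((l + k : ℕ) : ℂ))))
        ((1 / s : ℂ) ^ (α + n + 1) * (Complex.exp (-a / s) * ((-b / s) ^ l / l.factorial *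
          ∑ i ∈ Finset.range (n + l + 1), ((n + l).choose i : ℂ) * (-a / s) ^ i *
            (Complex.Gamma (α + i + 1))⁻¹))) := by
      intro l
      convert! (hasSum_kummer (n + l) hα (-a / s)).mul_left
        ((1 / s : ℂ) ^ (α + n + 1) * ((-b / s) ^ l / l.factorial)) using 1
      · ext k
        simp only [hβ]
        rw [Complex.cpow_add _ _ hs1, Complex.cpow_natCast,
          show α + n + 1 + ((l + k : ℕ) : ℂ) = α + (n + l : ℕ) + k + 1 by push_cast; ring,
          show α + n + l + 1 = α + (n + l : ℕ) + 1 by push_cast; ring]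
        simp only [div_pow, one_pow, pow_add]
        field_simp
      · ring
    have h2 := hS.prod_fiberwise h1
    exact h2.unique (((hasSum_exp_mul_clifford n α (-a / s) (-b / s)).mul_left _).mul_left _)
  · intro t ht
    have ht' : (t : ℂ) ≠ 0 := by exact_mod_cast ht.ne'
    have h1 := hasSum_clifford_mul_clifford (α + n) α (-b * t) (-a * t)
    convert! h1.mul_left ((t : ℂ) ^ (α + n)) using 1
    ext i
    simp only [hβ]
    rw [show α + n + 1 + ((i.1 + i.2 : ℕ) : ℂ) - 1 = α + n + ((i.1 + i.2 : ℕ) : ℂ) by ring,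
      Complex.cpow_add _ _ ht', Complex.cpow_natCast, pow_add, mul_pow, mul_pow]
    ring

/-! ### The dilated integrand and its majorants -/

/-- `τ ^ p (z/|z|) ^ (2p) J_{2p}(√τ |z|)`, written as a manifestly smooth function. -/
def planarBessel (p : ℕ) (τ : ℝ) (z : ℂ) : ℂ :=
  (τ : ℂ) ^ (2 * p) * (z / 2) ^ (2 * p) *
    clifford (2 * p : ℕ) ((-(‖z‖ / 2) ^ 2 * τ : ℝ) : ℂ)

theorem continuous_planarBessel (p : ℕ) :
    Continuous fun q : ℝ × ℂ => planarBessel p q.1 q.2 := by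
  have := continuous_clifford (2 * p : ℕ)
  unfold planarBessel
  fun_prop

theorem exists_norm_planarBessel_pow_four_le (p : ℕ) : ∃ C : ℝ, 0 ≤ C ∧ ∀ (τ : ℝ) (z : ℂ), 0 ≤ τ →
    ‖planarBessel p τ z‖ ^ 4 * (1 + τ * ‖z‖ ^ 2) ≤ C * (τ ^ p) ^ 4 := by
  obtain ⟨C, hC, h⟩ := exists_pow_four_besselJ_le (2 * p)
  refine ⟨C, hC, fun τ z hτ => ?_⟩
  have h1 := h (√τ * ‖z‖) (by positivity)
  have hs : √τ ^ 2 = τ := Real.sq_sqrt hτ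
  have e1 : -(√τ * ‖z‖ / 2) ^ 2 = -(‖z‖ / 2) ^ 2 * τ := by
    rw [mul_div_assoc, mul_pow, hs]; ring
  have e2 : (√τ * ‖z‖ / 2) ^ (2 * p) = τ ^ p * (‖z‖ / 2) ^ (2 * p) := by
    rw [mul_div_assoc, mul_pow, pow_mul (√τ), hs]
  set c : ℂ := clifford (2 * p : ℕ) ((-(‖z‖ / 2) ^ 2 * τ : ℝ) : ℂ) with hc
  have e3 : ‖c‖ = |c.re| := by
    have him : c.im = 0 := clifford_nat_ofReal_im (2 * p) _
    rw [← Complex.re_add_im c, him]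
    simp [← Real.norm_eq_abs]
  have e4 : ‖planarBessel p τ z‖ ^ 4 = (τ ^ p) ^ 4 * ((√τ * ‖z‖ / 2) ^ (2 * p) * c.re) ^ 4 := by
    unfold planarBessel
    rw [← hc, norm_mul, norm_mul, norm_pow, norm_pow, Complex.norm_real, Real.norm_of_nonneg hτ,
      norm_div, e3, e2]
    have : |c.re| ^ 4 = c.re ^ 4 := by
      rw [← abs_pow]; exact abs_of_nonneg (by positivity)
    rw [mul_pow, this]
    simp only [Complex.norm_ofNat, pow_mul]
    ring
  rw [e1] at h1
  have e5 : (√τ * ‖z‖) ^ 2 = τ * ‖z‖ ^ 2 := by rw [mul_pow, hs]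
  rw [e5] at h1
  rw [e4, mul_assoc, mul_comm]
  exact mul_le_mul_of_nonneg_right h1 (by positivity)

/-- The weight `min (√y) (1/√y)`. -/
def decayWeight (y : ℝ) : ℝ := min (y ^ (1 / 2 : ℝ)) (y ^ (-1 / 2 : ℝ))

theorem decayWeight_nonneg {y : ℝ} (hy : 0 < y) : 0 ≤ decayWeight y :=
  le_min (by positivity) (by positivity)

theorem decayWeight_of_le_one {y : ℝ} (hy : 0 < y) (h : y ≤ 1) :
    decayWeight y = y ^ (1 / 2 : ℝ) :=
  min_eq_left (Real.rpow_le_rpow_of_exponent_ge hy h (by norm_num))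

theorem decayWeight_of_one_le {y : ℝ} (h : 1 ≤ y) : decayWeight y = y ^ (-1 / 2 : ℝ) :=
  min_eq_right (Real.rpow_le_rpow_of_exponent_le h (by norm_num))

theorem one_le_decayWeight_pow_four_mul {y : ℝ} (hy : 0 < y) :
    1 ≤ decayWeight y ^ 4 * (y ^ 2 + (y ^ 2)⁻¹) := by
  rcases le_total y 1 with h | h
  · rw [decayWeight_of_le_one hy h, ← Real.rpow_natCast, ← Real.rpow_mul hy.le,
      show (1 / 2 : ℝ) * (4 : ℕ) = (2 : ℕ) by norm_num, Real.rpow_natCast, mul_add,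
      mul_inv_cancel₀ (by positivity)]
    linarith [show 0 ≤ y ^ 2 * y ^ 2 by positivity]
  · rw [decayWeight_of_one_le h, ← Real.rpow_natCast, ← Real.rpow_mul hy.le,
      show (-1 / 2 : ℝ) * (4 : ℕ) = -(2 : ℕ) by norm_num, Real.rpow_neg hy.le, Real.rpow_natCast,
      mul_add, inv_mul_cancel₀ (by positivity)]
    linarith [show 0 ≤ (y ^ 2)⁻¹ * (y ^ 2)⁻¹ by positivity]

/-- The exponents are `2σ - 1/2` at 0 and `2σ - 3/2` at infinity; both converge exactly when `|σ| <
1/4`. -/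
theorem integrableOn_rpow_mul_decayWeight {σ : ℝ} (hσ : |σ| < 1 / 4) :
    IntegrableOn (fun y => y ^ (2 * σ - 1) * decayWeight y) (Ioi 0) := by
  obtain ⟨h1, h2⟩ := abs_lt.1 hσ
  rw [← Ioc_union_Ioi_eq_Ioi (zero_le_one (α := ℝ)), integrableOn_union]
  constructor
  · have := (intervalIntegral.intervalIntegrable_rpow' (a := 0) (b := 1)
      (r := 2 * σ - 1 + 1 / 2) (by linarith)).1
    refine this.congr_fun (fun y hy => ?_) measurableSet_Ioc
    simp only
    rw [decayWeight_of_le_one hy.1 hy.2, Real.rpow_add hy.1]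
  · have := integrableOn_Ioi_rpow_of_lt (a := 2 * σ - 1 + -1 / 2) (by linarith) one_pos
    refine this.congr_fun (fun y hy => ?_) measurableSet_Ioi
    have hy' : 1 < y := hy
    simp only
    rw [decayWeight_of_one_le hy'.le, Real.rpow_add (by linarith)]

/-- The linear combination `y u + ū / y`. -/
def ellipse (u : ℂ) (y : ℝ) : ℂ := y * u + starRingEnd ℂ u / y

/-- The cross terms do not involve `y`, so a Gaussian in `ellipse u y` factors into constants and
the Macdonald integrand. -/
theorem normSq_ellipse (u : ℂ) {y : ℝ} (hy : 0 < y) :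
    ((‖ellipse u y‖ ^ 2 : ℝ) : ℂ) =
      u ^ 2 + starRingEnd ℂ u ^ 2 + (‖u‖ : ℂ) ^ 2 * ((y : ℂ) ^ 2 + ((y : ℂ) ^ 2)⁻¹) := by
  have hy' : (y : ℂ) ≠ 0 := by exact_mod_cast hy.ne'
  have h1 : (‖u‖ : ℂ) ^ 2 = u * starRingEnd ℂ u := by
    rw [Complex.mul_conj, Complex.normSq_eq_norm_sq]; push_cast; rfl
  rw [← Complex.normSq_eq_norm_sq, ← Complex.mul_conj, h1]
  unfold ellipse
  rw [map_add, map_mul, map_div₀, Complex.conj_conj, Complex.conj_ofReal]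
  field_simp
  ring

theorem norm_sq_mul_le_normSq_ellipse (u : ℂ) {y : ℝ} (hy : 0 < y) :
    ‖u‖ ^ 2 * (y ^ 2 + (y ^ 2)⁻¹) ≤ ‖ellipse u y‖ ^ 2 + 2 * ‖u‖ ^ 2 := by
  have h := congrArg Complex.re (normSq_ellipse u hy)
  have e : (‖u‖ : ℂ) ^ 2 * ((y : ℂ) ^ 2 + ((y : ℂ) ^ 2)⁻¹) =
      ((‖u‖ ^ 2 * (y ^ 2 + (y ^ 2)⁻¹) : ℝ) : ℂ) := by push_cast; rfl
  rw [e, Complex.ofReal_re, Complex.add_re, Complex.add_re, Complex.ofReal_re] at h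
  have h1 : -‖u‖ ^ 2 ≤ (u ^ 2).re := by
    have := Complex.abs_re_le_norm (u ^ 2)
    rw [norm_pow] at this
    exact (abs_le.1 this).1
  have h2 : -‖u‖ ^ 2 ≤ (starRingEnd ℂ u ^ 2).re := by
    have := Complex.abs_re_le_norm (starRingEnd ℂ u ^ 2)
    rw [norm_pow, Complex.norm_conj] at this
    exact (abs_le.1 this).1
  linarith

/-- The curve can pass through the origin, so `|z|²` is comparable to `y² + y⁻²` only up to an
additive `2|u|²`, which costs the factor `1 + 2|u|²τ`. Fourth powers are compared to avoid roots.
The singularity `τ^(-1/4)` is harmless under the Laplace transform. -/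
theorem exists_norm_planarBessel_ellipse_le (p : ℕ) {u : ℂ} (hu : u ≠ 0) :
    ∃ C : ℝ, 0 ≤ C ∧ ∀ τ y : ℝ, 0 < τ → 0 < y →
      ‖planarBessel p τ (ellipse u y)‖ ≤
        C * (τ ^ p * (τ ^ (-1 / 4 : ℝ) + 1)) * decayWeight y := by
  obtain ⟨C₀, hC₀, h⟩ := exists_norm_planarBessel_pow_four_le p
  have hr : 0 < ‖u‖ := norm_pos_iff.2 hu
  set K : ℝ := C₀ * (1 + 2 * ‖u‖ ^ 2) / ‖u‖ ^ 2 with hK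
  have hK0 : 0 ≤ K := by positivity
  refine ⟨K ^ (1 / 4 : ℝ), by positivity, fun τ y hτ hy => ?_⟩
  have hw := decayWeight_nonneg hy
  refine le_of_pow_le_pow_left₀ four_ne_zero (by positivity) ?_
  have hK4 : (K ^ (1 / 4 : ℝ)) ^ 4 = K := by
    rw [← Real.rpow_natCast, ← Real.rpow_mul hK0]; norm_num
  have hτ4 : (τ ^ (-1 / 4 : ℝ)) ^ 4 = τ⁻¹ := by
    rw [← Real.rpow_natCast, ← Real.rpow_mul hτ.le, ← Real.rpow_neg_one]; norm_num
  set P := ‖planarBessel p τ (ellipse u y)‖ ^ 4 with hP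
  set S := y ^ 2 + (y ^ 2)⁻¹ with hS
  have hS0 : 0 < S := by positivity
  have hP0 : 0 ≤ P := by positivity
  have h1 := h τ (ellipse u y) hτ.le
  have h2 := norm_sq_mul_le_normSq_ellipse u hy
  have h3 : τ * (‖u‖ ^ 2 * S) ≤
      (1 + τ * ‖ellipse u y‖ ^ 2) * (1 + 2 * ‖u‖ ^ 2 * τ) := by
    have : 0 ≤ τ * ‖ellipse u y‖ ^ 2 * (2 * ‖u‖ ^ 2 * τ) := by positivity
    nlinarith
  have h4 : P * (τ * (‖u‖ ^ 2 * S)) ≤ C₀ * (τ ^ p) ^ 4 * (1 + 2 * ‖u‖ ^ 2 * τ) := by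
    refine (mul_le_mul_of_nonneg_left h3 hP0).trans ?_
    rw [← mul_assoc]
    exact mul_le_mul_of_nonneg_right h1 (by positivity)
  have h5 : 1 + 2 * ‖u‖ ^ 2 * τ ≤ (1 + 2 * ‖u‖ ^ 2) * τ * (τ⁻¹ + 1) := by
    have : (1 + 2 * ‖u‖ ^ 2) * τ * (τ⁻¹ + 1) = (1 + 2 * ‖u‖ ^ 2) * (1 + τ) := by
      field_simp
    rw [this]
    nlinarith [sq_nonneg ‖u‖]
  have h6 : τ⁻¹ + 1 ≤ (τ ^ (-1 / 4 : ℝ) + 1) ^ 4 := by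
    rw [← hτ4]
    have : 0 ≤ τ ^ (-1 / 4 : ℝ) := by positivity
    nlinarith [pow_nonneg this 2, pow_nonneg this 3]
  have h7 : P * S ≤ K * (τ ^ p) ^ 4 * (τ ^ (-1 / 4 : ℝ) + 1) ^ 4 := by
    have e : K * (τ ^ p) ^ 4 * (τ ^ (-1 / 4 : ℝ) + 1) ^ 4 =
        C₀ * (τ ^ p) ^ 4 * ((1 + 2 * ‖u‖ ^ 2) * τ * (τ ^ (-1 / 4 : ℝ) + 1) ^ 4) /
          (τ * ‖u‖ ^ 2) := by
      rw [hK]; field_simp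
    rw [e, le_div_iff₀ (by positivity)]
    calc P * S * (τ * ‖u‖ ^ 2) = P * (τ * (‖u‖ ^ 2 * S)) := by ring
      _ ≤ C₀ * (τ ^ p) ^ 4 * (1 + 2 * ‖u‖ ^ 2 * τ) := h4
      _ ≤ _ := by
        gcongr
        exact h5.trans (by gcongr)
  have h8 := one_le_decayWeight_pow_four_mul hy
  calc P ≤ P * (decayWeight y ^ 4 * S) := le_mul_of_one_le_right hP0 h8
    _ = P * S * decayWeight y ^ 4 := by ring
    _ ≤ K * (τ ^ p) ^ 4 * (τ ^ (-1 / 4 : ℝ) + 1) ^ 4 * decayWeight y ^ 4 := by gcongr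
    _ = _ := by rw [mul_pow, mul_pow, mul_pow, hK4]; ring

/-! ### The `y`-integral as a function of `τ` and its Laplace transform -/

theorem continuousOn_ellipse (u : ℂ) : ContinuousOn (ellipse u) (Ioi 0) := by
  intro y hy
  have hy' : (y : ℂ) ≠ 0 := by exact_mod_cast (mem_Ioi.1 hy).ne'
  unfold ellipse
  exact ContinuousAt.continuousWithinAt (by fun_prop (disch := assumption))

theorem continuousOn_cpow_mul_planarBessel (ν : ℂ) (p : ℕ) (u : ℂ) :
    ContinuousOn (fun q : ℝ × ℝ => (q.2 : ℂ) ^ (2 * ν - 1) * planarBessel p q.1 (ellipse u q.2))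
      (Ioi 0 ×ˢ Ioi 0) := by
  have h1 : ContinuousOn (fun q : ℝ × ℝ => (q.2 : ℂ) ^ (2 * ν - 1)) (Ioi 0 ×ˢ Ioi 0) := by
    have h0 : ContinuousOn (fun y : ℝ => (y : ℂ) ^ (2 * ν - 1)) (Ioi 0) := fun y hy =>
      (Complex.continuousAt_ofReal_cpow_const _ _
        (Or.inr (mem_Ioi.1 hy).ne')).continuousWithinAt
    exact h0.comp continuousOn_snd fun q hq => hq.2
  have h2 : ContinuousOn (fun q : ℝ × ℝ => (q.1, ellipse u q.2)) (Ioi 0 ×ˢ Ioi 0) :=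
    continuousOn_fst.prodMk ((continuousOn_ellipse u).comp continuousOn_snd fun q hq => hq.2)
  have h3 : ContinuousOn (fun q : ℝ × ℝ => planarBessel p q.1 (ellipse u q.2))
      (Ioi 0 ×ˢ Ioi 0) :=
    Continuous.comp_continuousOn (g := fun q : ℝ × ℂ => planarBessel p q.1 q.2)
      (f := fun q : ℝ × ℝ => (q.1, ellipse u q.2)) (continuous_planarBessel p) h2
  exact h1.mul h3

theorem aestronglyMeasurable_cpow_mul_planarBessel (ν : ℂ) (p : ℕ) (u : ℂ) {τ : ℝ} (hτ : 0 < τ) :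
    AEStronglyMeasurable (fun y : ℝ => (y : ℂ) ^ (2 * ν - 1) * planarBessel p τ (ellipse u y))
      (volume.restrict (Ioi 0)) := by
  refine ContinuousOn.aestronglyMeasurable ?_ measurableSet_Ioi
  exact (continuousOn_cpow_mul_planarBessel ν p u).comp (f := fun y : ℝ => (τ, y))
    (by fun_prop) fun y hy => ⟨hτ, hy⟩

theorem norm_cpow_mul_le {ν z : ℂ} {B y : ℝ} (hy : 0 < y) (h : ‖z‖ ≤ B * decayWeight y) :
    ‖(y : ℂ) ^ (2 * ν - 1) * z‖ ≤ B * (y ^ (2 * ν.re - 1) * decayWeight y) := by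
  rw [norm_mul, Complex.norm_cpow_eq_rpow_re_of_pos hy]
  have e : (2 * ν - 1).re = 2 * ν.re - 1 := by simp
  rw [e]
  calc y ^ (2 * ν.re - 1) * ‖z‖ ≤ y ^ (2 * ν.re - 1) * (B * decayWeight y) := by gcongr
    _ = _ := by ring

theorem integrableOn_cpow_mul_planarBessel {ν : ℂ} (hν : |ν.re| < 1 / 4) (p : ℕ) {u : ℂ}
    (hu : u ≠ 0) {τ : ℝ} (hτ : 0 < τ) :
    IntegrableOn (fun y : ℝ => (y : ℂ) ^ (2 * ν - 1) * planarBessel p τ (ellipse u y))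
      (Ioi 0) := by
  obtain ⟨C, hC, h⟩ := exists_norm_planarBessel_ellipse_le p hu
  refine ((integrableOn_rpow_mul_decayWeight hν).const_mul
    (C * (τ ^ p * (τ ^ (-1 / 4 : ℝ) + 1)))).mono'
    (aestronglyMeasurable_cpow_mul_planarBessel ν p u hτ) ?_
  filter_upwards [self_mem_ae_restrict measurableSet_Ioi] with y hy
  exact norm_cpow_mul_le hy (h τ y hτ hy)

/-- Continuity in `τ` is what permits a pointwise conclusion from equal Laplace transforms. -/
theorem continuousOn_integral_cpow_mul_planarBessel {ν : ℂ} (hν : |ν.re| < 1 / 4) (p : ℕ) {u : ℂ}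
    (hu : u ≠ 0) :
    ContinuousOn (fun τ : ℝ => ∫ y : ℝ in Ioi 0,
      (y : ℂ) ^ (2 * ν - 1) * planarBessel p τ (ellipse u y)) (Ioi 0) := by
  obtain ⟨C, hC, h⟩ := exists_norm_planarBessel_ellipse_le p hu
  intro τ₀ hτ₀
  refine ContinuousAt.continuousWithinAt ?_
  have hK : ContinuousAt (fun τ : ℝ => C * (τ ^ p * (τ ^ (-1 / 4 : ℝ) + 1))) τ₀ :=
    continuousAt_const.mul ((continuousAt_id.pow p).mul
      ((Real.continuousAt_rpow_const _ _ (Or.inl (mem_Ioi.1 hτ₀).ne')).add continuousAt_const))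
  set K := C * (τ₀ ^ p * (τ₀ ^ (-1 / 4 : ℝ) + 1)) + 1
  have hK' : ∀ᶠ τ in 𝓝 τ₀, C * (τ ^ p * (τ ^ (-1 / 4 : ℝ) + 1)) ≤ K :=
    hK.tendsto.eventually_le_const (by simp [K])
  refine continuousAt_of_dominated (bound := fun y => K * (y ^ (2 * ν.re - 1) * decayWeight y))
    ((eventually_gt_nhds hτ₀).mono fun τ hτ =>
      aestronglyMeasurable_cpow_mul_planarBessel ν p u hτ) ?_
    ((integrableOn_rpow_mul_decayWeight hν).const_mul K) ?_
  · filter_upwards [eventually_gt_nhds hτ₀, hK'] with τ hτ hτK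
    filter_upwards [self_mem_ae_restrict measurableSet_Ioi] with y hy
    exact norm_cpow_mul_le hy ((h τ y hτ hy).trans
      (mul_le_mul_of_nonneg_right hτK (decayWeight_nonneg hy)))
  · refine Eventually.of_forall fun y => ?_
    have : Continuous fun τ : ℝ => planarBessel p τ (ellipse u y) :=
      (continuous_planarBessel p).comp (f := fun τ : ℝ => (τ, ellipse u y)) (by fun_prop)
    fun_prop

/-- Fubini applies because the majorant is a product of an integrable function of `τ` and one of
`y`. -/
theorem laplace_integral_cpow_mul_planarBessel {ν : ℂ} (hν : |ν.re| < 1 / 4) (p : ℕ) {u : ℂ}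
    (hu : u ≠ 0) {s : ℝ} (hs : 0 < s) :
    IntegrableOn (fun τ : ℝ => Real.exp (-s * τ) • ∫ y : ℝ in Ioi 0,
      (y : ℂ) ^ (2 * ν - 1) * planarBessel p τ (ellipse u y)) (Ioi 0) ∧
    ∫ τ : ℝ in Ioi 0, Real.exp (-s * τ) • ∫ y : ℝ in Ioi 0,
      (y : ℂ) ^ (2 * ν - 1) * planarBessel p τ (ellipse u y) =
    ∫ y : ℝ in Ioi 0, (y : ℂ) ^ (2 * ν - 1) * ((ellipse u y / 2) ^ (2 * p) *
      ((1 / s : ℂ) ^ (2 * p + 1) *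
        Complex.exp (-(((‖ellipse u y‖ / 2) ^ 2 : ℝ) : ℂ) / s))) := by
  obtain ⟨C, hC, h⟩ := exists_norm_planarBessel_ellipse_le p hu
  set H : ℝ × ℝ → ℂ := fun q => Real.exp (-s * q.1) •
    ((q.2 : ℂ) ^ (2 * ν - 1) * planarBessel p q.1 (ellipse u q.2)) with hH
  have hprod : (volume.restrict (Ioi (0 : ℝ))).prod (volume.restrict (Ioi (0 : ℝ))) =
      (volume.prod volume).restrict (Ioi 0 ×ˢ Ioi 0) := Measure.prod_restrict _ _
  have hτ : IntegrableOn (fun τ : ℝ => Real.exp (-s * τ) *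
      (C * (τ ^ p * (τ ^ (-1 / 4 : ℝ) + 1)))) (Ioi 0) := by
    have i1 := integrableOn_rpow_mul_exp_neg_mul_rpow (p := 1) (s := p + (-1 / 4 : ℝ)) (b := s)
      (by linarith [(Nat.cast_nonneg p : (0 : ℝ) ≤ p)]) one_pos hs
    have i2 := integrableOn_rpow_mul_exp_neg_mul_rpow (p := 1) (s := p) (b := s)
      (by linarith [(Nat.cast_nonneg p : (0 : ℝ) ≤ p)]) one_pos hs
    have i3 := (i1.add i2).const_mul C
    refine IntegrableOn.congr_fun i3 (fun τ hτ => ?_) measurableSet_Ioi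
    simp only [Pi.add_apply]
    rw [Real.rpow_add hτ, Real.rpow_natCast, Real.rpow_one]
    ring
  have hInt : Integrable H
      ((volume.restrict (Ioi (0 : ℝ))).prod (volume.restrict (Ioi (0 : ℝ)))) := by
    refine (hτ.mul_prod (integrableOn_rpow_mul_decayWeight hν)).mono' ?_ ?_
    · rw [hprod]
      refine ContinuousOn.aestronglyMeasurable ?_ (measurableSet_Ioi.prod measurableSet_Ioi)
      have he : Continuous fun q : ℝ × ℝ => Real.exp (-s * q.1) := by fun_prop
      exact he.continuousOn.smul (continuousOn_cpow_mul_planarBessel ν p u)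
    · rw [hprod]
      filter_upwards [self_mem_ae_restrict (measurableSet_Ioi.prod measurableSet_Ioi)] with q hq
      simp only [hH]
      rw [norm_smul, Real.norm_of_nonneg (Real.exp_pos _).le, mul_assoc]
      exact mul_le_mul_of_nonneg_left (norm_cpow_mul_le hq.2 (h q.1 q.2 hq.1 hq.2))
        (Real.exp_pos _).le
  have e1 : ∀ τ : ℝ, Real.exp (-s * τ) • (∫ y : ℝ in Ioi 0,
      (y : ℂ) ^ (2 * ν - 1) * planarBessel p τ (ellipse u y)) = ∫ y in Ioi 0, H (τ, y) := by
    intro τ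
    rw [← integral_smul]
  simp only [e1]
  refine ⟨hInt.integral_prod_left, ?_⟩
  rw [integral_integral_swap (f := fun τ y => H (τ, y)) hInt]
  refine setIntegral_congr_fun measurableSet_Ioi fun y hy => ?_
  have e2 : ∀ τ : ℝ, H (τ, y) = (y : ℂ) ^ (2 * ν - 1) * (ellipse u y / 2) ^ (2 * p) *
      (Real.exp (-s * τ) • ((τ : ℂ) ^ (2 * p) *
        clifford (2 * p : ℕ) (-(((‖ellipse u y‖ / 2) ^ 2 : ℝ) : ℂ) * τ))) := by
    intro τ
    simp only [hH, planarBessel, Complex.real_smul]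
    push_cast
    ring
  simp only [e2]
  rw [integral_const_mul, laplace_pow_mul_clifford _ _ hs, mul_assoc]

/-- The `j`-th binomial term of `ellipse ^ (2p)` carries `y^(2(j-p))`, which shifts the order of the
Macdonald function from `ν` to `ν + j - p`. -/
theorem integral_ellipse_pow_mul_exp {ν : ℂ} (hν : ∀ n : ℤ, ν ≠ n) (p : ℕ) {u : ℂ} (hu : u ≠ 0)
    {s X : ℝ} (hs : 0 < s) (hX : X = 1 / s * ‖u / 2‖ ^ 2) :
    ∫ y : ℝ in Ioi 0, (y : ℂ) ^ (2 * ν - 1) * ((ellipse u y / 2) ^ (2 * p) *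
      ((1 / s : ℂ) ^ (2 * p + 1) *
        Complex.exp (-(((‖ellipse u y‖ / 2) ^ 2 : ℝ) : ℂ) / s))) =
    (1 / s : ℂ) ^ (2 * p + 1) * (Complex.exp (-(u / 2) ^ 2 / s) *
      (Complex.exp (-(starRingEnd ℂ u / 2) ^ 2 / s) * ∑ j ∈ Finset.range (2 * p + 1),
        ((2 * p).choose j : ℂ) * (u / 2) ^ j * (starRingEnd ℂ u / 2) ^ (2 * p - j) *
          (Real.pi / Complex.sin (Real.pi * (ν + j - p)) / 2 *
            ((X : ℂ) ^ (-(ν + j - p)) * clifford (-(ν + j - p)) ((X : ℂ) ^ 2) -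
              (X : ℂ) ^ (ν + j - p) * clifford (ν + j - p) ((X : ℂ) ^ 2))))) := by
  have hs' : (s : ℂ) ≠ 0 := by exact_mod_cast hs.ne'
  have hX0 : 0 < X := by
    rw [hX]
    have : 0 < ‖u / 2‖ := norm_pos_iff.2 (div_ne_zero hu two_ne_zero)
    positivity
  have hj : ∀ j : ℕ, ∀ n : ℤ, ν + j - p ≠ n := fun j n h => hν (n - j + p) (by
    push_cast; linear_combination h)
  have hm := fun j : ℕ => mellin_exp_neg_mul_sq_add_inv_sq (hj j) hX0
  set κ : ℂ := (1 / s : ℂ) ^ (2 * p + 1) * (Complex.exp (-(u / 2) ^ 2 / s) *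
      Complex.exp (-(starRingEnd ℂ u / 2) ^ 2 / s)) with hκ
  have e : ∀ y ∈ Ioi (0 : ℝ), (y : ℂ) ^ (2 * ν - 1) * ((ellipse u y / 2) ^ (2 * p) *
      ((1 / s : ℂ) ^ (2 * p + 1) * Complex.exp (-(((‖ellipse u y‖ / 2) ^ 2 : ℝ) : ℂ) / s))) =
      κ * ∑ j ∈ Finset.range (2 * p + 1),
        ((2 * p).choose j : ℂ) * (u / 2) ^ j * (starRingEnd ℂ u / 2) ^ (2 * p - j) *
        ((y : ℂ) ^ (2 * (ν + j - p) - 1) •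
          ((Real.exp (-(X * (y ^ 2 + (y ^ 2)⁻¹))) : ℝ) : ℂ)) := by
    intro y hy
    have hy' : (y : ℂ) ≠ 0 := by exact_mod_cast (mem_Ioi.1 hy).ne'
    have e1 : Complex.exp (-(((‖ellipse u y‖ / 2) ^ 2 : ℝ) : ℂ) / s) =
        Complex.exp (-(u / 2) ^ 2 / s) * Complex.exp (-(starRingEnd ℂ u / 2) ^ 2 / s) *
          ((Real.exp (-(X * (y ^ 2 + (y ^ 2)⁻¹))) : ℝ) : ℂ) := by
      rw [Complex.ofReal_exp, ← Complex.exp_add, ← Complex.exp_add, div_pow, Complex.ofReal_div,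
        normSq_ellipse u hy, hX, norm_div]
      congr 1
      push_cast
      rw [Complex.norm_ofNat]
      push_cast
      field_simp
      ring
    have e2 : (y : ℂ) ^ (2 * ν - 1) * (ellipse u y / 2) ^ (2 * p) =
        ∑ j ∈ Finset.range (2 * p + 1),
          ((2 * p).choose j : ℂ) * (u / 2) ^ j * (starRingEnd ℂ u / 2) ^ (2 * p - j) *
          (y : ℂ) ^ (2 * (ν + j - p) - 1) := by
      have : ellipse u y / 2 = y * (u / 2) + starRingEnd ℂ u / 2 / y := by
        unfold ellipse; ring
      rw [this, add_pow, Finset.mul_sum]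
      refine Finset.sum_congr rfl fun j hj => ?_
      have hj' : j ≤ 2 * p := Nat.lt_succ_iff.1 (Finset.mem_range.1 hj)
      have e3 : 2 * (ν + j - p) - 1 = 2 * ν - 1 + j - (2 * p - j : ℕ) := by
        rw [Nat.cast_sub hj']; push_cast; ring
      rw [e3, Complex.cpow_sub _ ((2 * p - j : ℕ) : ℂ) hy',
        Complex.cpow_add (2 * ν - 1) _ hy', Complex.cpow_natCast,
        Complex.cpow_natCast, mul_pow, div_pow _ (y : ℂ)]
      ring
    rw [e1, hκ, ← mul_assoc ((y : ℂ) ^ (2 * ν - 1)), e2, Finset.sum_mul, Finset.mul_sum]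
    refine Finset.sum_congr rfl fun j _ => ?_
    rw [smul_eq_mul]
    ring
  rw [setIntegral_congr_fun measurableSet_Ioi e, integral_const_mul, integral_finsetSum]
  · simp only [integral_const_mul]
    have h2 : ∀ j : ℕ, ∫ y : ℝ in Ioi 0, (y : ℂ) ^ (2 * (ν + j - p) - 1) •
          ((Real.exp (-(X * (y ^ 2 + (y ^ 2)⁻¹))) : ℝ) : ℂ) = _ := fun j => (hm j).2
    simp only [h2]
    rw [hκ]
    ring
  · intro j _
    exact (hm j).1.const_mul _

/-! ### The kernel side: symmetry and Laplace transform -/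

/-- `τ ^ p` times the function `𝒥_{ν,p}` at `√τ u`. -/
def scaledScrJ (ν : ℂ) (p : ℕ) (u : ℂ) (τ : ℝ) : ℂ :=
  ((‖u / 2‖ : ℝ) : ℂ) ^ (2 * ν) * (u / (‖u‖ : ℂ)) ^ (-2 * (p : ℤ)) *
    ((τ : ℂ) ^ (ν + p) * (clifford (ν + p) (-(starRingEnd ℂ u / 2) ^ 2 * τ) *
      clifford (ν - p) (-(u / 2) ^ 2 * τ)))

theorem scaledScrJ_one (ν : ℂ) (p : ℕ) (u : ℂ) : scaledScrJ ν p u 1 = scrJ ν p u := by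
  unfold scaledScrJ scrJ
  rw [besselJStar_eq, besselJStar_eq, Complex.ofReal_one, Complex.one_cpow, mul_one, mul_one,
    Int.cast_natCast]
  ring

/-- Conjugation inverts `u/|u|` and exchanges the two Bessel factors. -/
theorem scrJ_neg_right (ν : ℂ) (p : ℤ) {u : ℂ} (hu : u ≠ 0) :
    scrJ ν (-p) u = scrJ ν p (starRingEnd ℂ u) := by
  have hr : (‖u‖ : ℂ) ≠ 0 := by exact_mod_cast norm_ne_zero_iff.2 hu
  have h1 : starRingEnd ℂ u / (‖u‖ : ℂ) = (u / (‖u‖ : ℂ))⁻¹ := by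
    rw [inv_div, div_eq_div_iff hr hu, mul_comm, Complex.mul_conj, Complex.normSq_eq_norm_sq]
    push_cast; ring
  have h2 : ‖starRingEnd ℂ u / 2‖ = ‖u / 2‖ := by
    rw [norm_div, norm_div, Complex.norm_conj]
  unfold scrJ
  rw [Complex.norm_conj, h1, h2, inv_zpow', Complex.conj_conj]
  push_cast
  rw [sub_neg_eq_add, ← sub_eq_add_neg ν, mul_neg, neg_mul]
  ring

theorem kernelQuotient_neg_right (ν : ℂ) (p : ℤ) {u : ℂ} (hu : u ≠ 0) :
    kernelQuotient ν (-p) u = kernelQuotient ν p (starRingEnd ℂ u) := by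
  unfold kernelQuotient
  rw [scrJ_neg_right ν p hu, scrJ_neg_right (-ν) (-p) hu]

theorem scrK_neg_right (ν : ℂ) (p : ℤ) {u : ℂ} (hu : u ≠ 0) :
    scrK ν (-p) u = scrK ν p (starRingEnd ℂ u) := by
  unfold scrK
  simp only [kernelQuotient_neg_right _ p hu]

theorem continuousOn_scaledScrJ (ν : ℂ) (p : ℕ) (u : ℂ) :
    ContinuousOn (scaledScrJ ν p u) (Ioi 0) := by
  have h1 := continuous_clifford (ν + p)
  have h2 := continuous_clifford (ν - p)
  refine ContinuousOn.mul continuousOn_const (ContinuousOn.mul (fun t ht => ?_) (by fun_prop))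
  exact (Complex.continuousAt_ofReal_cpow_const _ _
    (Or.inr (mem_Ioi.1 ht).ne')).continuousWithinAt

/-- The case `α = ν - p`, `n = 2p` of `laplace_clifford_mul_clifford`, with `a` and `b` the squares
of `u/2` and `ū/2`; the product of the two arguments is `X²`. -/
theorem laplace_scaledScrJ {ν : ℂ} (hν : ∀ n : ℤ, ν ≠ n) (hre : -1 < ν.re) (p : ℕ) {u : ℂ}
    (hu : u ≠ 0) {s X : ℝ} (hs : 0 < s) (hX : X = 1 / s * ‖u / 2‖ ^ 2) :
    IntegrableOn (fun t : ℝ => Real.exp (-s * t) • scaledScrJ ν p u t) (Ioi 0) ∧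
    ∫ t : ℝ in Ioi 0, Real.exp (-s * t) • scaledScrJ ν p u t =
      (1 / s : ℂ) ^ (2 * p + 1) * (Complex.exp (-(u / 2) ^ 2 / s) *
        (Complex.exp (-(starRingEnd ℂ u / 2) ^ 2 / s) * ∑ j ∈ Finset.range (2 * p + 1),
          ((2 * p).choose j : ℂ) * (-1) ^ j * (u / 2) ^ j *
            (starRingEnd ℂ u / 2) ^ (2 * p - j) *
            ((X : ℂ) ^ (ν + j - p) * clifford (ν + j - p) ((X : ℂ) ^ 2)))) := by
  have hs' : (s : ℂ) ≠ 0 := by exact_mod_cast hs.ne'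
  have hr : (‖u‖ : ℂ) ≠ 0 := by exact_mod_cast norm_ne_zero_iff.2 hu
  have hu2 : 0 < ‖u / 2‖ := norm_pos_iff.2 (div_ne_zero hu two_ne_zero)
  have hc : starRingEnd ℂ u ≠ 0 := (map_ne_zero _).2 hu
  have hX0 : 0 < X := by rw [hX]; positivity
  have hX' : (X : ℂ) ≠ 0 := by exact_mod_cast hX0.ne'
  have hα : ∀ n : ℤ, ν - p ≠ n := fun n h => hν (n + p) (by
    push_cast; linear_combination h)
  have hadd : ν - p + (2 * p : ℕ) = ν + p := by push_cast; ring
  have key := laplace_clifford_mul_clifford hα (2 * p) (by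
    rw [hadd, Complex.add_re, Complex.natCast_re]
    linarith [(Nat.cast_nonneg p : (0 : ℝ) ≤ p)]) ((u / 2) ^ 2) ((starRingEnd ℂ u / 2) ^ 2) hs
  rw [hadd] at key
  set c : ℂ := ((‖u / 2‖ : ℝ) : ℂ) ^ (2 * ν) * (u / (‖u‖ : ℂ)) ^ (-2 * (p : ℤ)) with hcdef
  have e : ∀ t : ℝ, Real.exp (-s * t) • scaledScrJ ν p u t = c * (Real.exp (-s * t) •
      ((t : ℂ) ^ (ν + p) * (clifford (ν + p) (-(starRingEnd ℂ u / 2) ^ 2 * t) *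
        clifford (ν - p) (-(u / 2) ^ 2 * t)))) := fun t => by
    simp only [scaledScrJ, Complex.real_smul]
    ring
  simp only [e]
  refine ⟨key.1.const_mul c, ?_⟩
  rw [integral_const_mul, key.2]
  have hsq : (‖u‖ : ℂ) ^ 2 = u * starRingEnd ℂ u := by
    rw [Complex.mul_conj, Complex.normSq_eq_norm_sq]; push_cast; rfl
  have hXu : (X : ℂ) = 1 / s * (u / 2) * (starRingEnd ℂ u / 2) := by
    rw [hX, norm_div]
    push_cast
    rw [Complex.norm_ofNat, div_pow, hsq]
    push_cast
    ring
  have hAB : -(u / 2) ^ 2 / s * (-(starRingEnd ℂ u / 2) ^ 2 / s) = (X : ℂ) ^ 2 := by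
    rw [hXu]; ring
  have hXν : (X : ℂ) ^ ν = (1 / s : ℂ) ^ ν * ((‖u / 2‖ : ℝ) : ℂ) ^ (2 * ν) := by
    have hn : ((‖u / 2‖ : ℝ) : ℂ) ≠ 0 := by exact_mod_cast hu2.ne'
    rw [hX, Complex.ofReal_mul, Complex.mul_cpow_ofReal_nonneg (by positivity) (by positivity),
      pow_two, Complex.ofReal_mul ‖u / 2‖, Complex.mul_cpow_ofReal_nonneg hu2.le hu2.le, two_mul,
      Complex.cpow_add _ _ hn]
    push_cast
    rfl
  have hph : (u / (‖u‖ : ℂ)) ^ (-2 * (p : ℤ)) = starRingEnd ℂ u ^ p / u ^ p := by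
    rw [zpow_mul, zpow_natCast, ← div_pow]
    congr 1
    rw [show (-2 : ℤ) = -(2 : ℕ) by rfl, zpow_neg, zpow_natCast, div_pow, hsq]
    field_simp
  -- The phase, the modulus and the powers of `1/s` recombine into `X^(ν+j-p)`, since `X =
  -- (u/2)(ū/2)/s`.
  have hterm : ∀ j ∈ Finset.range (2 * p + 1), c * (1 / s : ℂ) ^ (ν + p + 1) * (u / 2) ^ (2 * j) *
      (1 / s : ℂ) ^ j =
      (1 / s : ℂ) ^ (2 * p + 1) * ((u / 2) ^ j * (starRingEnd ℂ u / 2) ^ (2 * p - j)) *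
        (X : ℂ) ^ (ν + j - p) := by
    intro j hj
    have hj' : j ≤ 2 * p := Nat.lt_succ_iff.1 (Finset.mem_range.1 hj)
    have hq : (1 / s : ℂ) ≠ 0 := one_div_ne_zero hs'
    rw [hcdef, hph, Complex.cpow_sub _ _ hX', Complex.cpow_add _ _ hX', Complex.cpow_natCast,
      Complex.cpow_natCast, hXν, Complex.cpow_add _ _ hq, Complex.cpow_add _ _ hq,
      Complex.cpow_natCast, Complex.cpow_one, hXu]
    have hab : starRingEnd ℂ u ^ p / u ^ p = (starRingEnd ℂ u / 2) ^ p / (u / 2) ^ p := by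
      rw [div_pow, div_pow]; field_simp
    have hb : (starRingEnd ℂ u / 2) ^ (2 * p - j) =
        (starRingEnd ℂ u / 2) ^ p * (starRingEnd ℂ u / 2) ^ p / (starRingEnd ℂ u / 2) ^ j := by
      rw [eq_div_iff (pow_ne_zero _ (div_ne_zero hc two_ne_zero)), ← pow_add, ← pow_add]
      congr 1; omega
    rw [hab, hb]
    have ha0 : u / 2 ≠ 0 := div_ne_zero hu two_ne_zero
    have hb0 : starRingEnd ℂ u / 2 ≠ 0 := div_ne_zero hc two_ne_zero
    generalize u / 2 = a at ha0 ⊢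
    generalize starRingEnd ℂ u / 2 = b at hb0 ⊢
    generalize (1 / s : ℂ) = q at hq ⊢
    generalize q ^ ν = Q
    simp only [mul_pow]
    field_simp
    ring
  rw [hAB, Finset.mul_sum, Finset.mul_sum, Finset.mul_sum, Finset.mul_sum, Finset.mul_sum,
    Finset.mul_sum, Finset.mul_sum]
  refine Finset.sum_congr rfl fun j hj => ?_
  rw [show ν - p + j = ν + j - p by ring]
  have e4 : (-(u / 2) ^ 2 / (s : ℂ)) ^ j = (-1) ^ j * ((u / 2) ^ (2 * j) * (1 / s : ℂ) ^ j) := by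
    rw [pow_mul, ← mul_pow, ← mul_pow]; congr 1; ring
  rw [e4]
  linear_combination (Complex.exp (-(u / 2) ^ 2 / s) *
    Complex.exp (-(starRingEnd ℂ u / 2) ^ 2 / s) * ((2 * p).choose j : ℂ) * (-1) ^ j *
    clifford (ν + j - p) ((X : ℂ) ^ 2)) * hterm j hj

/-! ### Comparison of the transforms, and the point `ν = 0` -/

theorem laplace_kernel_eq {ν : ℂ} (hν : ∀ n : ℤ, ν ≠ n) (hre : |ν.re| < 1 / 4) (p : ℕ) {u : ℂ}
    (hu : u ≠ 0) {s : ℝ} (hs : 0 < s) :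
    (∫ t : ℝ in Ioi 0, Real.exp (-s * t) • scaledScrJ (-ν) p (starRingEnd ℂ u) t) -
        ∫ t : ℝ in Ioi 0, Real.exp (-s * t) • scaledScrJ ν p u t =
      Complex.sin (Real.pi * ν) * ((-1) ^ p * (2 / Real.pi)) *
        ∫ t : ℝ in Ioi 0, Real.exp (-s * t) • ∫ y : ℝ in Ioi 0,
          (y : ℂ) ^ (2 * ν - 1) * planarBessel p t (ellipse u y) := by
  obtain ⟨h1, h2⟩ := abs_lt.1 hre
  set X : ℝ := 1 / s * ‖u / 2‖ ^ 2 with hX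
  have hc : starRingEnd ℂ u ≠ 0 := (map_ne_zero _).2 hu
  have hX' : X = 1 / s * ‖starRingEnd ℂ u / 2‖ ^ 2 := by
    rw [hX, norm_div, norm_div, Complex.norm_conj]
  have hνneg : ∀ n : ℤ, -ν ≠ n := fun n h => hν (-n) (by push_cast; linear_combination -h)
  have hsin : Complex.sin (Real.pi * ν) ≠ 0 := by
    rw [Complex.sin_ne_zero_iff]
    intro k hk
    have : (Real.pi : ℂ) ≠ 0 := by exact_mod_cast Real.pi_ne_zero
    exact hν k (mul_left_cancel₀ this (by rw [hk]; ring))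
  rw [(laplace_scaledScrJ hν (by linarith) p hu hs hX).2,
    (laplace_scaledScrJ hνneg (by rw [Complex.neg_re]; linarith) p hc hs hX').2,
    (laplace_integral_cpow_mul_planarBessel hre p hu hs).2,
    integral_ellipse_pow_mul_exp hν p hu hs hX, Complex.conj_conj]
  -- Under `j ↦ 2p - j`, the order `-ν + j - p` becomes `-(ν + j - p)`, so the two sums can be
  -- compared term by term.
  rw [← Finset.sum_range_reflect (fun j => ((2 * p).choose j : ℂ) * (-1) ^ j *
    (starRingEnd ℂ u / 2) ^ j * (u / 2) ^ (2 * p - j) *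
    ((X : ℂ) ^ (-ν + j - p) * clifford (-ν + j - p) ((X : ℂ) ^ 2)))]
  have e : ∑ j ∈ Finset.range (2 * p + 1), ((2 * p).choose (2 * p + 1 - 1 - j) : ℂ) *
      (-1) ^ (2 * p + 1 - 1 - j) * (starRingEnd ℂ u / 2) ^ (2 * p + 1 - 1 - j) *
      (u / 2) ^ (2 * p - (2 * p + 1 - 1 - j)) *
      ((X : ℂ) ^ (-ν + (2 * p + 1 - 1 - j : ℕ) - p) *
        clifford (-ν + (2 * p + 1 - 1 - j : ℕ) - p) ((X : ℂ) ^ 2)) -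
      ∑ j ∈ Finset.range (2 * p + 1), ((2 * p).choose j : ℂ) * (-1) ^ j * (u / 2) ^ j *
        (starRingEnd ℂ u / 2) ^ (2 * p - j) *
        ((X : ℂ) ^ (ν + j - p) * clifford (ν + j - p) ((X : ℂ) ^ 2)) =
      Complex.sin (Real.pi * ν) * ((-1) ^ p * (2 / Real.pi)) *
        ∑ j ∈ Finset.range (2 * p + 1),
        ((2 * p).choose j : ℂ) * (u / 2) ^ j * (starRingEnd ℂ u / 2) ^ (2 * p - j) *
          (Real.pi / Complex.sin (Real.pi * (ν + j - p)) / 2 *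
            ((X : ℂ) ^ (-(ν + j - p)) * clifford (-(ν + j - p)) ((X : ℂ) ^ 2) -
              (X : ℂ) ^ (ν + j - p) * clifford (ν + j - p) ((X : ℂ) ^ 2))) := by
    rw [← Finset.sum_sub_distrib, Finset.mul_sum]
    refine Finset.sum_congr rfl fun j hj => ?_
    have hj' : j ≤ 2 * p := Nat.lt_succ_iff.1 (Finset.mem_range.1 hj)
    have i1 : 2 * p + 1 - 1 - j = 2 * p - j := rfl
    have i2 : 2 * p - (2 * p - j) = j := Nat.sub_sub_self hj'
    have i3 : -ν + (2 * p - j : ℕ) - p = -(ν + j - p) := by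
      rw [Nat.cast_sub hj']; push_cast; ring
    have i4 : (-1 : ℂ) ^ (2 * p - j) = (-1) ^ j := by
      have hj0 : (-1 : ℂ) ^ j ≠ 0 := pow_ne_zero _ (by norm_num)
      refine mul_right_cancel₀ hj0 ?_
      rw [← pow_add, Nat.sub_add_cancel hj', ← mul_pow, pow_mul]
      simp
    have i5 : Complex.sin (Real.pi * (ν + j - p)) = (-1) ^ j * (-1) ^ p *
        Complex.sin (Real.pi * ν) := by
      rw [show Real.pi * (ν + j - p) = Real.pi * ν + j * Real.pi - p * Real.pi by ring,
        Complex.sin_antiperiodic.sub_nat_mul_eq p, Complex.sin_antiperiodic.add_nat_mul_eq j]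
      ring
    have hπ : (Real.pi : ℂ) ≠ 0 := by exact_mod_cast Real.pi_ne_zero
    have s1 : ((-1 : ℂ) ^ j) * (-1) ^ j = 1 := by rw [← mul_pow]; simp
    -- The signs of `sin π(ν+j-p) = (-1)^(j+p) sin πν` cancel the prefactor `(-1)^p` and leave the
    -- `(-1)^j` of the kernel side.
    have i6 : Complex.sin (Real.pi * ν) * ((-1) ^ p * (2 / Real.pi)) *
        (Real.pi / Complex.sin (Real.pi * (ν + j - p)) / 2) = (-1) ^ j := by
      have hj0 : (-1 : ℂ) ^ j ≠ 0 := pow_ne_zero _ (by norm_num)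
      have hp0 : (-1 : ℂ) ^ p ≠ 0 := pow_ne_zero _ (by norm_num)
      rw [i5]
      field_simp
      linear_combination -s1
    rw [i1, i2, i3, i4, Nat.choose_symm hj']
    linear_combination -((2 * p).choose j : ℂ) * (u / 2) ^ j *
      (starRingEnd ℂ u / 2) ^ (2 * p - j) *
            ((X : ℂ) ^ (-(ν + j - p)) * clifford (-(ν + j - p)) ((X : ℂ) ^ 2) -
              (X : ℂ) ^ (ν + j - p) * clifford (ν + j - p) ((X : ℂ) ^ 2)) * i6
  linear_combination ((1 / s : ℂ) ^ (2 * p + 1) * (Complex.exp (-(u / 2) ^ 2 / s) *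
      Complex.exp (-(starRingEnd ℂ u / 2) ^ 2 / s))) * e

theorem kernelQuotient_eq_of_ne_int {ν : ℂ} (hν : ∀ n : ℤ, ν ≠ n) (hre : |ν.re| < 1 / 4) (p : ℕ)
    {u : ℂ} (hu : u ≠ 0) :
    kernelQuotient ν p u = (-1) ^ p * (2 / Real.pi) *
      ∫ y : ℝ in Ioi 0, (y : ℂ) ^ (2 * ν - 1) * planarBessel p 1 (ellipse u y) := by
  obtain ⟨h1, h2⟩ := abs_lt.1 hre
  have hc : starRingEnd ℂ u ≠ 0 := (map_ne_zero _).2 hu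
  have hνneg : ∀ n : ℤ, -ν ≠ n := fun n h => hν (-n) (by push_cast; linear_combination -h)
  have hsin : Complex.sin (Real.pi * ν) ≠ 0 := by
    rw [Complex.sin_ne_zero_iff]
    intro k hk
    have : (Real.pi : ℂ) ≠ 0 := by exact_mod_cast Real.pi_ne_zero
    exact hν k (mul_left_cancel₀ this (by rw [hk]; ring))
  set κ : ℂ := Complex.sin (Real.pi * ν) * ((-1) ^ p * (2 / Real.pi)) with hκ
  set I : ℝ → ℂ := fun t => ∫ y : ℝ in Ioi 0,
    (y : ℂ) ^ (2 * ν - 1) * planarBessel p t (ellipse u y) with hI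
  have iJ : ∀ s : ℝ, 0 < s → IntegrableOn (fun t : ℝ => Real.exp (-s * t) • scaledScrJ ν p u t)
      (Ioi 0) := fun s hs => (laplace_scaledScrJ hν (by linarith) p hu hs rfl).1
  have iJ' : ∀ s : ℝ, 0 < s → IntegrableOn
      (fun t : ℝ => Real.exp (-s * t) • scaledScrJ (-ν) p (starRingEnd ℂ u) t) (Ioi 0) :=
    fun s hs => (laplace_scaledScrJ hνneg (by rw [Complex.neg_re]; linarith) p hc hs rfl).1
  have iI : ∀ s : ℝ, 0 < s → IntegrableOn (fun t : ℝ => Real.exp (-s * t) • I t) (Ioi 0) :=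
    fun s hs => (laplace_integral_cpow_mul_planarBessel hre p hu hs).1
  set G : ℝ → ℂ := fun t =>
    scaledScrJ (-ν) p (starRingEnd ℂ u) t - scaledScrJ ν p u t - κ * I t with hG
  have hGe : ∀ s t : ℝ, Real.exp (-s * t) • G t =
      Real.exp (-s * t) • scaledScrJ (-ν) p (starRingEnd ℂ u) t -
        Real.exp (-s * t) • scaledScrJ ν p u t - κ * (Real.exp (-s * t) • I t) := fun s t => by
    simp only [hG, Complex.real_smul]
    ring
  have hGz := eq_zero_of_laplace_eq_zero (G := G) ?_ ?_ ?_ one_pos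
  · have h3 : scrJ (-ν) (-p) u - scrJ ν p u = κ * I 1 := by
      rw [scrJ_neg_right _ _ hu, ← scaledScrJ_one, ← scaledScrJ_one]
      exact sub_eq_zero.1 hGz
    unfold kernelQuotient
    rw [h3, hκ, mul_assoc, mul_div_cancel_left₀ _ hsin]
  · exact ((continuousOn_scaledScrJ _ p _).sub (continuousOn_scaledScrJ _ p _)).sub
      (continuousOn_const.mul (continuousOn_integral_cpow_mul_planarBessel hre p hu))
  · have := ((iJ' 1 one_pos).sub (iJ 1 one_pos)).sub ((iI 1 one_pos).const_mul κ)
    refine this.congr (Eventually.of_forall fun t => ?_)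
    have := hGe 1 t
    simp only [neg_mul, one_mul] at this
    simp only [Pi.sub_apply, neg_mul, one_mul]
    rw [this]
  · intro n
    have hn : (0 : ℝ) < ((n + 1 : ℕ) : ℝ) := by positivity
    simp only [hGe]
    have h3 : IntegrableOn (fun t : ℝ =>
        Real.exp (-((n + 1 : ℕ) : ℝ) * t) • scaledScrJ (-ν) p (starRingEnd ℂ u) t -
          Real.exp (-((n + 1 : ℕ) : ℝ) * t) • scaledScrJ ν p u t) (Ioi 0) :=
      (iJ' _ hn).sub (iJ _ hn)
    rw [integral_sub h3 ((iI _ hn).const_mul κ), integral_sub (iJ' _ hn) (iJ _ hn),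
      integral_const_mul, laplace_kernel_eq hν hre p hu hn,
      sub_self]

theorem continuousAt_integral_cpow_mul_planarBessel (p : ℕ) {u : ℂ} (hu : u ≠ 0) :
    ContinuousAt (fun ν : ℂ => ∫ y : ℝ in Ioi 0,
      (y : ℂ) ^ (2 * ν - 1) * planarBessel p 1 (ellipse u y)) 0 := by
  obtain ⟨C, hC, h⟩ := exists_norm_planarBessel_ellipse_le p hu
  set K := C * ((1 : ℝ) ^ p * ((1 : ℝ) ^ (-1 / 4 : ℝ) + 1)) with hK
  have hK0 : 0 ≤ K := by positivity
  -- For `|Re ν| < 1/8`, the power of `y` is at most the sum of the powers for `σ = ±1/8`, one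
  -- serving `y ≥ 1` and the other `y ≤ 1`.
  have i1 := integrableOn_rpow_mul_decayWeight (σ := 1 / 8) (by norm_num [abs_of_pos])
  have i2 := integrableOn_rpow_mul_decayWeight (σ := -1 / 8) (by norm_num [abs_of_neg, abs_lt])
  refine continuousAt_of_dominated (bound := fun y => K * (y ^ (2 * (1 / 8 : ℝ) - 1) * decayWeight y +
      y ^ (2 * (-1 / 8 : ℝ) - 1) * decayWeight y))
    (Eventually.of_forall fun ν => aestronglyMeasurable_cpow_mul_planarBessel ν p u one_pos) ?_
    ((i1.add i2).const_mul K) ?_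
  · have hν : ∀ᶠ ν : ℂ in 𝓝 0, |ν.re| < 1 / 8 := by
      have : Continuous fun ν : ℂ => |ν.re| := by fun_prop
      exact this.continuousAt.eventually_lt continuousAt_const (by norm_num)
    filter_upwards [hν] with ν hν
    obtain ⟨h1, h2⟩ := abs_lt.1 hν
    filter_upwards [self_mem_ae_restrict measurableSet_Ioi] with y hy
    have hy' : 0 < y := hy
    refine (norm_cpow_mul_le hy (h 1 y one_pos hy)).trans (mul_le_mul_of_nonneg_left ?_ hK0)
    rw [← add_mul]
    refine mul_le_mul_of_nonneg_right ?_ (decayWeight_nonneg hy)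
    have p1 : 0 ≤ y ^ (2 * (1 / 8 : ℝ) - 1) := by positivity
    have p2 : 0 ≤ y ^ (2 * (-1 / 8 : ℝ) - 1) := by positivity
    rcases le_total y 1 with hy1 | hy1
    · have := Real.rpow_le_rpow_of_exponent_ge hy' hy1
        (show 2 * (-1 / 8 : ℝ) - 1 ≤ 2 * ν.re - 1 by linarith)
      linarith
    · have := Real.rpow_le_rpow_of_exponent_le hy1
        (show 2 * ν.re - 1 ≤ 2 * (1 / 8 : ℝ) - 1 by linarith)
      linarith
  · filter_upwards [self_mem_ae_restrict measurableSet_Ioi] with y hy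
    have hy' : (y : ℂ) ≠ 0 := by exact_mod_cast (mem_Ioi.1 hy).ne'
    refine ContinuousAt.mul ?_ continuousAt_const
    exact ContinuousAt.const_cpow (by fun_prop) (Or.inl hy')

theorem scrK_eq {ν : ℂ} (hre : |ν.re| < 1 / 4) (p : ℕ) {u : ℂ} (hu : u ≠ 0) :
    scrK ν p u = (-1) ^ p * (2 / Real.pi) *
      ∫ y : ℝ in Ioi 0, (y : ℂ) ^ (2 * ν - 1) * planarBessel p 1 (ellipse u y) := by
  have hπ : (Real.pi : ℂ) ≠ 0 := by exact_mod_cast Real.pi_ne_zero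
  have small : ∀ {ν : ℂ}, |ν.re| < 1 / 4 → ν ≠ 0 → ∀ n : ℤ, ν ≠ n := by
    intro ν hν h0 n hn
    rw [hn, Complex.intCast_re] at hν
    have h1 : |(n : ℝ)| < 1 := by linarith
    have h2 : n = 0 := by
      rw [← Int.cast_abs] at h1
      have : |n| < 1 := by exact_mod_cast h1
      exact Int.abs_lt_one_iff.1 this
    exact h0 (by rw [hn, h2, Int.cast_zero])
  unfold scrK
  split_ifs with h
  -- In the strip `|Re ν| < 1/4` the only zero of `sin πν` is 0. The limit there is found from the
  -- formula at nonintegral `ν` by continuity.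
  · have h0 : ν = 0 := by
      by_contra hne
      obtain ⟨k, hk⟩ := Complex.sin_eq_zero_iff.1 h
      exact small hre hne k (mul_left_cancel₀ hπ (by rw [hk]; ring))
    subst h0
    refine Tendsto.limUnder_eq ?_
    have h1 := ((continuousAt_integral_cpow_mul_planarBessel p hu).tendsto.const_mul
      ((-1 : ℂ) ^ p * (2 / Real.pi))).mono_left (nhdsWithin_le_nhds (s := {0}ᶜ))
    refine h1.congr' ?_
    have hν : ∀ᶠ ν : ℂ in 𝓝 0, |ν.re| < 1 / 4 := by
      have : Continuous fun ν : ℂ => |ν.re| := by fun_prop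
      exact this.continuousAt.eventually_lt continuousAt_const (by norm_num)
    filter_upwards [self_mem_nhdsWithin, nhdsWithin_le_nhds hν] with s hs0 hs
    exact (kernelQuotient_eq_of_ne_int (small hs hs0) hs p hu).symm
  · refine kernelQuotient_eq_of_ne_int (small hre ?_) hre p hu
    rintro rfl
    simp at h

/-! ### Return to the stated integrand, and negative `p` -/

theorem norm_mul_joukowski (u : ℂ) {ϑ : ℝ} (hϑ : u = (‖u‖ : ℂ) * Complex.exp (Complex.I * ϑ))
    (y : ℝ) : (‖u‖ : ℂ) * joukowski ϑ y = ellipse u y := by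
  have hc : starRingEnd ℂ u = ‖u‖ * (Complex.exp (Complex.I * ϑ))⁻¹ := by
    conv_lhs => rw [hϑ]
    rw [map_mul, Complex.conj_ofReal, ← Complex.exp_conj, map_mul, Complex.conj_I,
      Complex.conj_ofReal, neg_mul, Complex.exp_neg]
  unfold joukowski ellipse
  rw [hc, mul_inv]
  linear_combination -(y : ℂ) * hϑ

theorem integrand_eq (ν : ℂ) (p : ℕ) {u : ℂ} (hu : u ≠ 0) {ϑ : ℝ}
    (hϑ : u = (‖u‖ : ℂ) * Complex.exp (Complex.I * ϑ)) (y : ℝ) :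
    integrand ν p ‖u‖ ϑ y = (y : ℂ) ^ (2 * ν - 1) * planarBessel p 1 (ellipse u y) := by
  have hr : (‖u‖ : ℂ) ≠ 0 := by exact_mod_cast norm_ne_zero_iff.2 hu
  unfold integrand planarBessel besselJ
  rw [← norm_mul_joukowski u hϑ, besselJStar_eq, norm_mul, Complex.norm_real, norm_norm]
  set x := joukowski ϑ y
  have e1 : ((2 * (p : ℤ) : ℤ) : ℂ) = ((2 * p : ℕ) : ℂ) := by push_cast; rfl
  have e2 : (2 * (p : ℤ)) = ((2 * p : ℕ) : ℤ) := by push_cast; rfl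
  have e3 : (x / (‖x‖ : ℂ)) ^ (2 * p) * (((‖u‖ * ‖x‖ : ℝ) : ℂ) / 2) ^ (2 * p) =
      (‖u‖ * x / 2) ^ (2 * p) := by
    -- At `x = 0` the quotient `x / ‖x‖` is 0 by default. Both sides vanish if `p > 0` and equal 1
    -- if `p = 0`.
    rcases eq_or_ne x 0 with hx | hx
    · rcases Nat.eq_zero_or_pos p with rfl | hp
      · simp
      · simp [hx, hp.ne']
    · have hx' : (‖x‖ : ℂ) ≠ 0 := by exact_mod_cast norm_ne_zero_iff.2 hx
      rw [← mul_pow]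
      congr 1
      push_cast
      field_simp
  rw [e1, e2, zpow_natCast, zpow_natCast, ← e3]
  push_cast
  rw [mul_one, one_pow]
  ring

/-- The relation `J_{-n} = (-1)^n J_n` for even `n`; at `z = 0` it relies on `0⁻¹ = 0`. -/
theorem besselJ_neg_even (p : ℕ) (z : ℂ) : besselJ (2 * -(p : ℤ)) z = besselJ (2 * p) z := by
  unfold besselJ
  have e1 : ((2 * -(p : ℤ) : ℤ) : ℂ) = -((2 * p : ℕ) : ℂ) := by push_cast; ring
  have e2 : ((2 * (p : ℤ) : ℤ) : ℂ) = ((2 * p : ℕ) : ℂ) := by push_cast; rfl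
  have e3 : (2 * (p : ℤ)) = ((2 * p : ℕ) : ℤ) := by push_cast; rfl
  rw [besselJStar_eq, besselJStar_eq, e1, e2, clifford_neg_nat, mul_neg, e3, zpow_neg,
    zpow_natCast]
  rcases Nat.eq_zero_or_pos p with rfl | hp
  · simp
  · rcases eq_or_ne (z / 2) 0 with hz | hz
    · simp [hz, hp.ne']
    · generalize z / 2 = x at hz ⊢
      rw [neg_pow (x ^ 2), Even.neg_one_pow (even_two_mul p)]
      field_simp
      ring

theorem joukowski_neg (ϑ y : ℝ) : joukowski (-ϑ) y = starRingEnd ℂ (joukowski ϑ y) := by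
  unfold joukowski
  rw [map_add, map_inv₀, map_mul, Complex.conj_ofReal, ← Complex.exp_conj, map_mul, Complex.conj_I,
    Complex.conj_ofReal]
  push_cast
  rw [mul_neg, neg_mul]

theorem integrand_neg (ν : ℂ) (p : ℕ) (r ϑ y : ℝ) :
    integrand ν (-p) r ϑ y = integrand ν p r (-ϑ) y := by
  unfold integrand
  rw [besselJ_neg_even, joukowski_neg, Complex.norm_conj]
  set x := joukowski ϑ y
  congr 2
  rcases eq_or_ne x 0 with hx | hx
  · rcases Nat.eq_zero_or_pos p with rfl | hp
    · simp
    · have h1 : (2 * -(p : ℤ)) ≠ 0 := by omega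
      have h2 : (2 * (p : ℤ)) ≠ 0 := by omega
      simp only [hx, zero_div, map_zero]
      rw [zero_zpow _ h1, zero_zpow _ h2]
  · have hx' : (‖x‖ : ℂ) ≠ 0 := by exact_mod_cast norm_ne_zero_iff.2 hx
    have : starRingEnd ℂ x / (‖x‖ : ℂ) = (x / (‖x‖ : ℂ))⁻¹ := by
      rw [inv_div, div_eq_div_iff hx' hx, mul_comm, Complex.mul_conj, Complex.normSq_eq_norm_sq]
      push_cast; ring
    rw [this, inv_zpow', mul_neg]

theorem scrK_eq_integral_integrand {ν : ℂ} (hν : |ν.re| < 1 / 4) (p : ℕ) {u : ℂ} (hu : u ≠ 0)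
    {ϑ : ℝ} (hϑ : u = (‖u‖ : ℂ) * Complex.exp (Complex.I * ϑ)) :
    IntegrableOn (integrand ν p ‖u‖ ϑ) (Ioi 0) ∧
    scrK ν p u = (-1 : ℂ) ^ p * (2 / (Real.pi : ℂ)) *
      ∫ y in Ioi (0 : ℝ), integrand ν p ‖u‖ ϑ y := by
  have e := fun y => integrand_eq ν p hu hϑ y
  constructor
  · rw [funext e]
    exact integrableOn_cpow_mul_planarBessel hν p hu one_pos
  · simp only [e]
    exact scrK_eq hν p hu

end BesselKernel

end

theorem theorem12p1 (ν : ℂ) (hν : |ν.re| < 1 / 4) (p : ℤ) (u : ℂ) (hu : u ≠ 0)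
    (ϑ : ℝ) (hϑ : u = (‖u‖ : ℂ) * Complex.exp (Complex.I * ϑ)) :
    MeasureTheory.IntegrableOn (BesselKernel.integrand ν p ‖u‖ ϑ) (Set.Ioi 0) ∧
    BesselKernel.scrK ν p u =
      (-1 : ℂ) ^ p * (2 / (Real.pi : ℂ)) *
        ∫ y in Set.Ioi (0 : ℝ), BesselKernel.integrand ν p ‖u‖ ϑ y := by
  obtain ⟨n, rfl | rfl⟩ := p.eq_nat_or_neg
  · rw [zpow_natCast]
    exact BesselKernel.scrK_eq_integral_integrand hν n hu hϑ
  -- Changing the sign of `p` amounts to conjugating `u` in the kernel and to `ϑ ↦ -ϑ` in the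
  -- integrand, so the case of `ū` and `n ≥ 0` applies.
  · have hc : starRingEnd ℂ u ≠ 0 := (map_ne_zero _).2 hu
    have hϑ' : starRingEnd ℂ u =
        (‖starRingEnd ℂ u‖ : ℂ) * Complex.exp (Complex.I * ((-ϑ : ℝ) : ℂ)) := by
      conv_lhs => rw [hϑ]
      rw [Complex.norm_conj, map_mul, Complex.conj_ofReal, ← Complex.exp_conj, map_mul,
        Complex.conj_I, Complex.conj_ofReal]
      push_cast
      rw [mul_neg, neg_mul]
    have h := BesselKernel.scrK_eq_integral_integrand hν n hc hϑ'
    rw [Complex.norm_conj] at h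
    have e := fun y => BesselKernel.integrand_neg ν n ‖u‖ ϑ y
    rw [funext e, BesselKernel.scrK_neg_right ν n hu, zpow_neg, zpow_natCast, ← inv_pow,
      show (-1 : ℂ)⁻¹ = -1 by norm_num]
    exact h
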